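/- Let $F$ be an algebraically closed field of characteristic $0$ and let $S$ be an infinite-dimensional linearly compact Lie superalgebra over $F$. Let $\mathrm{Aut}\,S$ be the group of continuous (parity-preserving) automorphisms of $S$, and let $\mathrm{Der}\,S$ be the Lie superalgebra of continuous derivations of $S$, with the topology of uniform convergence. Let $$S=S_{-d}\supset S_{-d+1}\supset\dots\supset S_0\supset S_1\supset\dots$$ be a filtration of $S$ by open ($\mathbb Z/2$-graded) subspaces such that $[S_i,S_j]\subset S_{i+j}$ for all $i,j$ (in particular $S_j$ is a subalgebra for $j\ge 0$) and $\bigcap_j S_j=0$; put $S_j=S$ for $j<-d$. Suppose that every $S_j$ is $\mathrm{Aut}\,S$-invariant and that the associated graded Lie superalgebra $\mathrm{Gr}\,S=\bigoplus_{j\ge -d}\mathfrak g_j$, $\mathfrak g_j=S_j/S_{j+1}$, is transitive, which means: if $a\in\mathfrak g_j$, $j\geq 0$, and $[a,\mathfrak g_{-1}]=0$, then $a=0$; and $\mathfrak g_{-n-1}=[\mathfrak g_{-1},\mathfrak g_{-n}]$ for all $n\ge 1$. Let $\mathrm{Aut}(\mathrm{Gr}\,S)$ be the group of automorphisms of $\mathrm{Gr}\,S$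 preserving the grading, let $\mathrm{Autgr}\,S\subset \mathrm{Aut}(\mathrm{Gr}\,S)$ be the image, and $\mathrm{Autf}\,S\subset\mathrm{Aut}\,S$ the kernel, of the natural homomorphism $\mathrm{Aut}\,S\to\mathrm{Aut}(\mathrm{Gr}\,S)$. Then: (a) The restriction map $\mathrm{Autgr}\,S\to GL(\mathfrak g_{-1})$ is injective. (b) Let $\mathrm{Aut}\,S$ act on $\mathrm{Der}\,S$ by conjugation, $D\mapsto\sigma D\sigma^{-1}$. Every $\sigma\in\mathrm{Autf}\,S$ acts on $\mathrm{Der}\,S$ as an inner automorphism, i.e. as an element of the group generated by the automorphisms $\exp(\mathrm{ad}\,a)$, where $a\in \mathrm{Der}\,S$ is even and the exponential series converges. In fact $\mathrm{Autf}\,S=\exp \mathrm{ad}\,(\mathrm{Der}\,S)_1$, where $(\mathrm{Der}\,S)_1=\{D\in\mathrm{Der}\,S\mid D(S_j)\subset S_{j+1}\text{ for all }j\}$: for each even $D\in(\mathrm{Der}\,S)_1$ the series $\exp D$ and $\exp(\mathrm{ad}\,D)$ converge on $S$ and on $\mathrm{Der}\,S$, $\exp D$ is an element $\sigma$ of $\mathrm{Autf}\,S$,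 and $\sigma D'\sigma^{-1}=\exp(\mathrm{ad}\,D)(D')$ for all $D'\in\mathrm{Der}\,S$; and every element of $\mathrm{Autf}\,S$ is of this form. (c) Suppose that there are ($\mathbb Z/2$-graded) subspaces $\mathfrak g_j\subset S_j$ of $S$ such that $S_j=\mathfrak g_j\oplus S_{j+1}$ for all $j$, and $[\mathfrak g_i,\mathfrak g_j]\subset\mathfrak g_{i+j}$ for all $i,j$. Then $\mathrm{Autgr}\,S=\mathrm{Aut}(\mathrm{Gr}\,S)$, and $$\mathrm{Aut}\,S=\mathrm{Autf}\,S\rtimes\mathrm{Aut}(\mathrm{Gr}\,S),$$ where $\mathrm{Aut}(\mathrm{Gr}\,S)$ is embedded in $\mathrm{Aut}\,S$ as a section of $\mathrm{Aut}\,S\to\mathrm{Aut}(\mathrm{Gr}\,S)$: $\varphi\in\mathrm{Aut}(\mathrm{Gr}\,S)$ goes to an automorphism of $S$ that maps every subspace $\mathfrak g_j$ of $S$ to itself and acts on it as $\varphi$ does on $S_j/S_{j+1}\cong \mathfrak g_j$. -/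

import Mathlib

open Filter Topology

noncomputable section

/-- A Lie superalgebra over `F`: a `ℤ/2`-graded vector space with an even bilinear bracket which is
super-skew-symmetric and satisfies the super Jacobi identity. -/
class LieSuperalgebra (F : Type*) (L : Type*) [Field F] [AddCommGroup L] [Module F L] where
  parity : ZMod 2 → Submodule F L
  isCompl_parity : IsCompl (parity 0) (parity 1)
  bracket : L →ₗ[F] L →ₗ[F] L
  bracket_mem : ∀ {i j : ZMod 2} {x y : L}, x ∈ parity i → y ∈ parity j →
    bracket x y ∈ parity (i + j)
  skew : ∀ {i j : ZMod 2} {x y : L}, x ∈ parity i → y ∈ parity j →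
    bracket x y = -((-1 : F) ^ (i.val * j.val) • bracket y x)
  jacobi : ∀ {i j k : ZMod 2} {x y z : L}, x ∈ parity i → y ∈ parity j → z ∈ parity k →
    bracket x (bracket y z) =
      bracket (bracket x y) z + (-1 : F) ^ (i.val * j.val) • bracket y (bracket x z)

namespace LieSuperalgebra

lemma continuous_smul_of_isLinearTopology (F : Type*) {L : Type*} [Field F] [AddCommGroup L]
    [Module F L] [TopologicalSpace L] [IsTopologicalAddGroup L] [IsLinearTopology F L] (c : F) :
    Continuous fun x : L => c • x := by
  refine continuous_of_continuousAt_zero (DistribSMul.toAddMonoidHom L c) ?_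
  have := IsLinearTopology.tendsto_smul_zero F (f := 𝓝 (0 : L)) (fun _ => c) id tendsto_id
  rw [ContinuousAt, map_zero]
  exact this

variable (F : Type*) {L : Type*} [Field F] [AddCommGroup L] [Module F L] [LieSuperalgebra F L]

/-- The bracket `[x, y]`. -/
abbrev br (x y : L) : L := bracket (F := F) x y

/-- The subspaces of a vector superspace: those spanned by their even and odd elements. -/
def IsSuperSubspace (P : Submodule F L) : Prop :=
  P ≤ (P ⊓ parity 0) ⊔ (P ⊓ parity 1)

variable (L)

/-- The group of automorphisms of a Lie superalgebra. -/
def Aut : Subgroup (L ≃ₗ[F] L) where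
  carrier := {g | (∀ (i : ZMod 2) (x : L), g x ∈ parity (F := F) i ↔ x ∈ parity (F := F) i) ∧
    ∀ x y : L, g (br F x y) = br F (g x) (g y)}
  mul_mem' := by
    rintro a b ⟨ha, ha'⟩ ⟨hb, hb'⟩
    exact ⟨fun i x => (ha i _).trans (hb i x), fun x y => by simp [hb', ha']⟩
  one_mem' := ⟨fun _ _ => Iff.rfl, fun _ _ => rfl⟩
  inv_mem' := by
    rintro a ⟨ha, ha'⟩
    have key : ∀ x, a (a⁻¹ x) = x := fun x => a.apply_symm_apply x
    refine ⟨fun i x => by rw [← ha, key], fun x y => a.injective ?_⟩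
    rw [key, ha', key, key]

/-- The group of continuous automorphisms of a topological Lie superalgebra. -/
def ContAut [TopologicalSpace L] : Subgroup (L ≃ₗ[F] L) where
  carrier := {g | g ∈ Aut F L ∧ Continuous g ∧ Continuous g.symm}
  mul_mem' := by
    rintro a b ⟨ha, ha', ha''⟩ ⟨hb, hb', hb''⟩
    exact ⟨mul_mem ha hb, ha'.comp hb', hb''.comp ha''⟩
  one_mem' := ⟨one_mem _, continuous_id, continuous_id⟩
  inv_mem' := by
    rintro a ⟨ha, ha', ha''⟩
    exact ⟨inv_mem ha, ha'', ha'⟩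

variable {L}

/-- The exponential series of the linear operator `T` converges (pointwise, in the topology of `L`)
and its sum is the map `g`. -/
def IsExp [TopologicalSpace L] (T : L →ₗ[F] L) (g : L → L) : Prop :=
  ∀ x : L, Tendsto (fun N : ℕ => ∑ n ∈ Finset.range N, ((n.factorial : F)⁻¹) • (T ^ n) x)
    atTop (𝓝 (g x))

variable (L)

/-- The group of inner automorphisms of a topological Lie superalgebra: the group generated by the
automorphisms `exp (ad a)`, for those even `a` for which the series converges. -/
def InnerAut [TopologicalSpace L] : Subgroup (ContAut F L) :=
  Subgroup.closure {g | ∃ a ∈ parity (F := F) (L := L) 0, IsExp F (bracket a) (g : L ≃ₗ[F] L)}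

/-- The set `exp (ad A)`, for a subspace `A` of a topological Lie superalgebra `L`, inside the group
of continuous automorphisms of `L` (only even elements are exponentiated). -/
def expAd [TopologicalSpace L] (A : Submodule F L) : Set (ContAut F L) :=
  {g | ∃ a ∈ A ⊓ parity 0, IsExp F (bracket a) (g : L ≃ₗ[F] L)}

/-- Linearly compact Lie superalgebras over the (discrete) field `F`: the topology is linear and
Hausdorff, every family of closed affine subspaces with the finite intersection property has a
common point, the even and odd parts are closed, and the bracket is continuous. -/
structure IsLinearlyCompact [TopologicalSpace L] : Prop where
  isTopologicalAddGroup : IsTopologicalAddGroup L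
  isLinearTopology : IsLinearTopology F L
  t2 : T2Space L
  inter_nonempty : ∀ 𝒞 : Set (AffineSubspace F L), (∀ A ∈ 𝒞, IsClosed (A : Set L)) →
    (∀ t : Finset (AffineSubspace F L), (t : Set (AffineSubspace F L)) ⊆ 𝒞 →
      (⋂ A ∈ t, (A : Set L)).Nonempty) →
    (⋂ A ∈ 𝒞, (A : Set L)).Nonempty
  isClosed_parity : ∀ i : ZMod 2, IsClosed (parity (F := F) (L := L) i : Set L)
  continuous_bracket : Continuous fun p : L × L => br F p.1 p.2

/-! ### Continuous derivations -/

variable {L}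

/-- The linear maps of parity `p`. -/
def endParity (p : ZMod 2) : Submodule F (Module.End F L) where
  carrier := {T | ∀ i, ∀ x ∈ parity (F := F) (L := L) i, T x ∈ parity (F := F) (p + i)}
  add_mem' := fun ha hb i x hx => add_mem (ha i x hx) (hb i x hx)
  zero_mem' := fun _ _ _ => zero_mem _
  smul_mem' := fun c _ ha i x hx => Submodule.smul_mem _ c (ha i x hx)

/-- The projection of `L` onto its part of parity `i`. -/
def proj (i : ZMod 2) : Module.End F L :=
  if i = 0 then Submodule.projection (parity 0) (parity 1) isCompl_parity
  else Submodule.projection (parity 1) (parity 0) isCompl_parity.symm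

lemma zmod_two (i : ZMod 2) : i = 0 ∨ i = 1 := by revert i; decide

lemma proj_mem (i : ZMod 2) (x : L) : proj F i x ∈ parity (F := F) i := by
  obtain rfl | rfl := zmod_two i <;> simp [proj]

lemma proj_of_mem {i : ZMod 2} {x : L} (hx : x ∈ parity (F := F) i) : proj F i x = x := by
  obtain rfl | rfl := zmod_two i
  · rw [proj, if_pos rfl, Submodule.projection_apply, Submodule.projectionOnto_apply_of_mem_left _ hx]
  · rw [proj, if_neg one_ne_zero, Submodule.projection_apply,
      Submodule.projectionOnto_apply_of_mem_left _ hx]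

lemma proj_of_mem_ne {i j : ZMod 2} (hij : i ≠ j) {x : L} (hx : x ∈ parity (F := F) i) :
    proj F j x = 0 := by
  obtain rfl | rfl := zmod_two i <;> obtain rfl | rfl := zmod_two j
  · exact absurd rfl hij
  · rw [proj, if_neg one_ne_zero, Submodule.projection_apply,
      Submodule.projectionOnto_apply_of_mem_right _ hx, Submodule.coe_zero]
  · rw [proj, if_pos rfl, Submodule.projection_apply,
      Submodule.projectionOnto_apply_of_mem_right _ hx, Submodule.coe_zero]
  · exact absurd rfl hij

lemma exists_parity_add (x : L) : ∃ a ∈ parity (F := F) (L := L) 0,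
    ∃ b ∈ parity (F := F) (L := L) 1, a + b = x := by
  have h : x ∈ parity (F := F) (L := L) 0 ⊔ parity 1 := by
    rw [isCompl_parity.sup_eq_top]; trivial
  exact Submodule.mem_sup.1 h

lemma end_ext {S T : Module.End F L}
    (h : ∀ i, ∀ x ∈ parity (F := F) (L := L) i, S x = T x) : S = T := by
  ext x
  obtain ⟨a, ha, b, hb, rfl⟩ := exists_parity_add F x
  rw [map_add, map_add, h 0 a ha, h 1 b hb]

lemma eq_zero_of_parity {i j : ZMod 2} (hij : i ≠ j) {x : L} (hi : x ∈ parity (F := F) i)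
    (hj : x ∈ parity (F := F) j) : x = 0 := by
  rw [← proj_of_mem F hj, proj_of_mem_ne F hij hi]

/-- The odd component of a linear map. -/
def oddPart (T : Module.End F L) : Module.End F L := proj F 0 * T * proj F 1 + proj F 1 * T * proj F 0

lemma oddPart_of_even {T : Module.End F L} (hT : T ∈ endParity F 0) : oddPart F T = 0 := by
  refine end_ext F fun i x hx => ?_
  have h := hT i x hx
  rw [zero_add] at h
  obtain rfl | rfl := zmod_two i
  · simp [oddPart, proj_of_mem F hx, proj_of_mem_ne F (by decide : (0 : ZMod 2) ≠ 1) hx,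
      proj_of_mem_ne F (by decide : (0 : ZMod 2) ≠ 1) h]
  · simp [oddPart, proj_of_mem F hx, proj_of_mem_ne F (by decide : (1 : ZMod 2) ≠ 0) hx,
      proj_of_mem_ne F (by decide : (1 : ZMod 2) ≠ 0) h]

lemma oddPart_of_odd {T : Module.End F L} (hT : T ∈ endParity F 1) : oddPart F T = T := by
  refine end_ext F fun i x hx => ?_
  have h := hT i x hx
  obtain rfl | rfl := zmod_two i
  · simp [oddPart, proj_of_mem F hx, proj_of_mem_ne F (by decide : (0 : ZMod 2) ≠ 1) hx,
      proj_of_mem F (show T x ∈ parity (F := F) 1 from h)]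
  · simp [oddPart, proj_of_mem F hx, proj_of_mem_ne F (by decide : (1 : ZMod 2) ≠ 0) hx,
      proj_of_mem F (show T x ∈ parity (F := F) 0 from h)]

lemma oddPart_add (S T : Module.End F L) : oddPart F (S + T) = oddPart F S + oddPart F T := by
  simp only [oddPart, mul_add, add_mul]; abel

lemma oddPart_smul (c : F) (T : Module.End F L) : oddPart F (c • T) = c • oddPart F T := by
  simp only [oddPart, mul_smul_comm, smul_mul_assoc, smul_add]

/-- The supercommutator of linear maps, i.e. the bilinear operation that is equal to
`S T - (-1) ^ (p q) T S` if `S` has parity `p` and `T` has parity `q`, see `scomm_of_mem`. -/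
def scomm (S T : Module.End F L) : Module.End F L :=
  S * T - T * S + (2 : F) • (oddPart F T * oddPart F S)

lemma scomm_of_mem {p q : ZMod 2} {S T : Module.End F L} (hS : S ∈ endParity F p)
    (hT : T ∈ endParity F q) :
    scomm F S T = S * T - (-1 : F) ^ (p.val * q.val) • (T * S) := by
  have h1 : (1 : ZMod 2).val = 1 := rfl
  obtain rfl | rfl := zmod_two p <;> obtain rfl | rfl := zmod_two q
  · simp [scomm, oddPart_of_even F hS]
  · simp [scomm, oddPart_of_even F hS]
  · simp [scomm, oddPart_of_even F hT]
  · simp only [scomm, oddPart_of_odd F hS, oddPart_of_odd F hT, h1, mul_one, pow_one, neg_smul,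
      one_smul, two_smul]
    abel

lemma mul_mem_endParity {p q : ZMod 2} {S T : Module.End F L} (hS : S ∈ endParity F p)
    (hT : T ∈ endParity F q) : S * T ∈ endParity F (p + q) := fun i x hx => by
  have := hS _ _ (hT i x hx)
  rwa [← add_assoc] at this

lemma scomm_mem_endParity {p q : ZMod 2} {S T : Module.End F L} (hS : S ∈ endParity F p)
    (hT : T ∈ endParity F q) : scomm F S T ∈ endParity F (p + q) := by
  rw [scomm_of_mem F hS hT]
  refine sub_mem (mul_mem_endParity F hS hT) (Submodule.smul_mem _ _ ?_)
  rw [add_comm]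
  exact mul_mem_endParity F hT hS

section Der

variable [TopologicalSpace L]

variable (L) [IsTopologicalAddGroup L] [IsLinearTopology F L]

/-- The continuous derivations of parity `p` of `L`. -/
def derParity (p : ZMod 2) : Submodule F (Module.End F L) where
  carrier := {D | Continuous D ∧ D ∈ endParity F p ∧
    ∀ i : ZMod 2, ∀ x ∈ parity (F := F) (L := L) i, ∀ y : L,
      D (br F x y) = br F (D x) y + (-1 : F) ^ (p.val * i.val) • br F x (D y)}
  add_mem' := by
    rintro a b ⟨ha, ha', ha''⟩ ⟨hb, hb', hb''⟩
    refine ⟨ha.add hb, add_mem ha' hb', fun i x hx y => ?_⟩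
    simp only [br, LinearMap.add_apply, map_add, smul_add] at ha'' hb'' ⊢
    rw [ha'' i x hx y, hb'' i x hx y]
    abel
  zero_mem' := ⟨continuous_const, zero_mem _, fun i x hx y => by simp [br]⟩
  smul_mem' := by
    rintro c a ⟨ha, ha', ha''⟩
    refine ⟨(continuous_smul_of_isLinearTopology F c).comp ha, Submodule.smul_mem _ c ha',
      fun i x hx y => ?_⟩
    simp only [br, LinearMap.smul_apply, map_smul] at ha'' ⊢
    rw [ha'' i x hx y, smul_add, smul_comm c]

/-- The space `Der L` of continuous derivations of `L`, the direct sum of the space of the even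
derivations and the space of the odd ones. -/
def Der : Submodule F (Module.End F L) := derParity F L 0 ⊔ derParity F L 1

variable {F L}

lemma derParity_le_der (p : ZMod 2) : derParity F L p ≤ Der F L := by
  obtain rfl | rfl := zmod_two p
  exacts [le_sup_left, le_sup_right]

lemma scomm_mem_derParity {p q : ZMod 2} {S T : Module.End F L} (hS : S ∈ derParity F L p)
    (hT : T ∈ derParity F L q) : scomm F S T ∈ derParity F L (p + q) := by
  refine ⟨?_, scomm_mem_endParity F hS.2.1 hT.2.1, fun i x hx y => ?_⟩
  · rw [scomm_of_mem F hS.2.1 hT.2.1]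
    exact (hS.1.comp hT.1).sub ((continuous_smul_of_isLinearTopology F _).comp (hT.1.comp hS.1))
  · rw [scomm_of_mem F hS.2.1 hT.2.1]
    have e1 := hS.2.2 i x hx
    have e2 := hT.2.2 i x hx
    have e3 := hS.2.2 _ _ (hT.2.1 i x hx)
    have e4 := hT.2.2 _ _ (hS.2.1 i x hx)
    simp only [br, LinearMap.sub_apply, LinearMap.smul_apply, Module.End.mul_apply, map_smul, map_sub] at e1 e2 e3 e4 ⊢
    simp only [e1, e2, e3, e4, map_add, map_smul]
    have h1 : (1 : ZMod 2).val = 1 := rfl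
    have h2 : (1 + 1 : ZMod 2) = 0 := rfl
    obtain rfl | rfl := zmod_two p <;> obtain rfl | rfl := zmod_two q <;>
      obtain rfl | rfl := zmod_two i <;>
      simp [h1, h2] <;> abel

lemma scomm_mem_der {S T : Module.End F L} (hS : S ∈ Der F L) (hT : T ∈ Der F L) :
    scomm F S T ∈ Der F L := by
  obtain ⟨a, ha, b, hb, rfl⟩ := Submodule.mem_sup.1 hS
  obtain ⟨c, hc, d, hd, rfl⟩ := Submodule.mem_sup.1 hT
  have key : scomm F (a + b) (c + d) = scomm F a c + scomm F a d + scomm F b c + scomm F b d := by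
    simp only [scomm, oddPart_add, mul_add, add_mul, smul_add]; abel
  rw [key]
  exact add_mem (add_mem (add_mem (derParity_le_der _ (scomm_mem_derParity ha hc))
    (derParity_le_der _ (scomm_mem_derParity ha hd)))
    (derParity_le_der _ (scomm_mem_derParity hb hc)))
    (derParity_le_der _ (scomm_mem_derParity hb hd))

/-- `Der L` is a Lie superalgebra with respect to the supercommutator. -/
instance instLieSuperalgebraDer : LieSuperalgebra F (Der F L) where
  parity p := (derParity F L p).comap (Der F L).subtype
  isCompl_parity := by
    constructor
    · rw [Submodule.disjoint_def]
      intro T h0 h1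
      refine Subtype.ext (end_ext F fun i x hx => ?_)
      refine eq_zero_of_parity F (i := 0 + i) (j := 1 + i) ?_ (h0.2.1 i x hx) (h1.2.1 i x hx)
      clear hx
      revert i
      decide
    · rw [codisjoint_iff_le_sup]
      rintro ⟨T, hT⟩ -
      obtain ⟨a, ha, b, hb, rfl⟩ := Submodule.mem_sup.1 hT
      exact Submodule.mem_sup.2 ⟨⟨a, derParity_le_der 0 ha⟩, ha, ⟨b, derParity_le_der 1 hb⟩, hb, rfl⟩
  bracket := LinearMap.mk₂ F (fun S T => ⟨scomm F S.1 T.1, scomm_mem_der S.2 T.2⟩)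
    (fun a b c => Subtype.ext (by
      simp only [scomm, oddPart_add, mul_add, add_mul, smul_add, Submodule.coe_add]; abel))
    (fun c a b => Subtype.ext (by
      simp only [scomm, oddPart_smul, mul_smul_comm, smul_mul_assoc, Submodule.coe_smul, smul_add,
        smul_sub, smul_comm c]))
    (fun a b c => Subtype.ext (by
      simp only [scomm, oddPart_add, mul_add, add_mul, smul_add, Submodule.coe_add]; abel))
    (fun c a b => Subtype.ext (by
      simp only [scomm, oddPart_smul, mul_smul_comm, smul_mul_assoc, Submodule.coe_smul, smul_add,
        smul_sub, smul_comm c]))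
  bracket_mem := fun hx hy => scomm_mem_derParity hx hy
  skew := by
    intro i j x y hx hy
    refine Subtype.ext ?_
    change scomm F x.1 y.1 = -((-1 : F) ^ (i.val * j.val) • scomm F y.1 x.1)
    have hx : x.1 ∈ endParity F i := hx.2.1
    have hy : y.1 ∈ endParity F j := hy.2.1
    rw [scomm_of_mem F hx hy, scomm_of_mem F hy hx]
    have h1 : (1 : ZMod 2).val = 1 := rfl
    obtain rfl | rfl := zmod_two i <;> obtain rfl | rfl := zmod_two j <;> simp [h1, add_comm]
  jacobi := by
    intro i j k x y z hx hy hz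
    refine Subtype.ext ?_
    change scomm F x.1 (scomm F y.1 z.1) = scomm F (scomm F x.1 y.1) z.1 +
      (-1 : F) ^ (i.val * j.val) • scomm F y.1 (scomm F x.1 z.1)
    have hx : x.1 ∈ endParity F i := hx.2.1
    have hy : y.1 ∈ endParity F j := hy.2.1
    have hz : z.1 ∈ endParity F k := hz.2.1
    rw [scomm_of_mem F hx (scomm_mem_endParity F hy hz),
      scomm_of_mem F (scomm_mem_endParity F hx hy) hz,
      scomm_of_mem F hy (scomm_mem_endParity F hx hz),
      scomm_of_mem F hx hy, scomm_of_mem F hx hz, scomm_of_mem F hy hz]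
    have h1 : (1 : ZMod 2).val = 1 := rfl
    have h2 : (1 + 1 : ZMod 2) = 0 := rfl
    obtain rfl | rfl := zmod_two i <;> obtain rfl | rfl := zmod_two j <;>
      obtain rfl | rfl := zmod_two k <;>
      simp [h1, h2, mul_sub, sub_mul, mul_add, add_mul, mul_assoc] <;> abel

/-- The topology of uniform convergence on `Der L` (the linearly compact-open topology if `L` is
linearly compact): a basis of neighbourhoods of `0` is given by the sets `{D | D L ⊆ U}`, where `U`
is a neighbourhood of `0` in `L`. -/
instance instTopologicalSpaceDer : TopologicalSpace (Der F L) :=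
  letI : UniformSpace L := IsTopologicalAddGroup.rightUniformSpace L
  TopologicalSpace.induced (fun D => UniformFun.ofFun (fun x : L => D.1 x)) inferInstance

/-! ### The action of `Aut L` on `Der L` by conjugation -/

lemma conj_mem_derParity (σ : ContAut F L) {p : ZMod 2} {D : Module.End F L}
    (hD : D ∈ derParity F L p) : LinearEquiv.conj (σ : L ≃ₗ[F] L) D ∈ derParity F L p := by
  obtain ⟨σ, ⟨h1, h2⟩, h3, h4⟩ := σ
  have key : ∀ x, σ (σ.symm x) = x := σ.apply_symm_apply
  have hs : ∀ x y, σ.symm (br F x y) = br F (σ.symm x) (σ.symm y) := fun x y =>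
    σ.injective (by rw [h2, key, key, key])
  have hp : ∀ i x, x ∈ parity (F := F) (L := L) i → σ.symm x ∈ parity (F := F) i := fun i x hx => by
    rwa [← h1, key]
  refine ⟨h3.comp (hD.1.comp h4), fun i x hx => (h1 _ _).2 (hD.2.1 i _ (hp i x hx)),
    fun i x hx y => ?_⟩
  simp only [LinearEquiv.conj_apply_apply, hs, hD.2.2 i _ (hp i x hx), map_add, map_smul, h2, key]

lemma conj_mem_der (σ : ContAut F L) {D : Module.End F L}
    (hD : D ∈ Der F L) : LinearEquiv.conj (σ : L ≃ₗ[F] L) D ∈ Der F L := by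
  obtain ⟨a, ha, b, hb, rfl⟩ := Submodule.mem_sup.1 hD
  rw [map_add]
  exact add_mem (derParity_le_der _ (conj_mem_derParity σ ha))
    (derParity_le_der _ (conj_mem_derParity σ hb))

/-- The linear automorphism `D ↦ σ D σ⁻¹` of `Der L`. -/
def conjDerEquiv (σ : ContAut F L) : Der F L ≃ₗ[F] Der F L where
  toFun D := ⟨LinearEquiv.conj (σ : L ≃ₗ[F] L) D.1, conj_mem_der σ D.2⟩
  invFun D := ⟨LinearEquiv.conj ((σ⁻¹ : ContAut F L) : L ≃ₗ[F] L) D.1, conj_mem_der σ⁻¹ D.2⟩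
  map_add' a b := Subtype.ext (map_add _ _ _)
  map_smul' c a := Subtype.ext (map_smul _ _ _)
  left_inv D := Subtype.ext (LinearMap.ext fun x => by
    change σ.1.symm (σ.1 (D.1 (σ.1.symm (σ.1 x)))) = D.1 x
    simp)
  right_inv D := Subtype.ext (LinearMap.ext fun x => by
    change σ.1 (σ.1.symm (D.1 (σ.1 (σ.1.symm x)))) = D.1 x
    simp)

lemma continuous_conjDerEquiv (σ : ContAut F L) : Continuous (conjDerEquiv σ) := by
  let _ : UniformSpace L := IsTopologicalAddGroup.rightUniformSpace L
  have : IsUniformAddGroup L := isUniformAddGroup_of_addCommGroup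
  have hσ : UniformContinuous (σ : L ≃ₗ[F] L) :=
    uniformContinuous_addMonoidHom_of_continuous (f := ((σ : L ≃ₗ[F] L) : L →+ L)) σ.2.2.1
  refine continuous_induced_rng.2 ?_
  exact ((UniformFun.postcomp_uniformContinuous hσ).comp
    (UniformFun.precomp_uniformContinuous (f := ((σ : L ≃ₗ[F] L).symm : L → L)))).continuous.comp
    continuous_induced_dom

lemma conj_mem_derParity_iff (σ : ContAut F L) {p : ZMod 2} {D : Module.End F L} :
    LinearEquiv.conj (σ : L ≃ₗ[F] L) D ∈ derParity F L p ↔ D ∈ derParity F L p := by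
  refine ⟨fun h => ?_, conj_mem_derParity σ⟩
  have := conj_mem_derParity σ⁻¹ h
  convert this using 1
  refine LinearMap.ext fun x => ?_
  change _ = σ.1.symm (σ.1 (D (σ.1.symm (σ.1 x))))
  simp

lemma conjDerEquiv_mem_aut (σ : ContAut F L) : conjDerEquiv σ ∈ Aut F (Der F L) := by
  refine ⟨fun p D => conj_mem_derParity_iff σ, fun S T => ?_⟩
  have hmul : ∀ a b : Module.End F L, LinearEquiv.conj (σ : L ≃ₗ[F] L) (a * b) =
      LinearEquiv.conj (σ : L ≃ₗ[F] L) a * LinearEquiv.conj (σ : L ≃ₗ[F] L) b :=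
    fun a b => LinearMap.ext fun x => by simp [LinearEquiv.conj_apply_apply]
  have hproj : ∀ i, LinearEquiv.conj (σ : L ≃ₗ[F] L) (proj F i) = proj F i := by
    intro i
    refine end_ext F fun j x hx => ?_
    have hx' : σ.1.symm x ∈ parity (F := F) j := by
      rw [← σ.2.1.1 j]; simpa using hx
    rw [LinearEquiv.conj_apply_apply]
    by_cases hij : j = i
    · subst hij
      rw [proj_of_mem F hx, proj_of_mem F hx']
      simp
    · rw [proj_of_mem_ne F hij hx, proj_of_mem_ne F hij hx', map_zero]
  refine Subtype.ext ?_
  change LinearEquiv.conj (σ : L ≃ₗ[F] L) (scomm F S.1 T.1) =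
    scomm F (LinearEquiv.conj (σ : L ≃ₗ[F] L) S.1) (LinearEquiv.conj (σ : L ≃ₗ[F] L) T.1)
  simp only [scomm, oddPart, map_add, map_sub, map_smul, hmul, hproj]

/-- The action of the group of continuous automorphisms of `L` on `Der L` by conjugation,
`D ↦ σ D σ⁻¹`. -/
def conjDer : ContAut F L →* ContAut F (Der F L) where
  toFun σ := ⟨conjDerEquiv σ, conjDerEquiv_mem_aut σ, continuous_conjDerEquiv σ,
    continuous_conjDerEquiv σ⁻¹⟩
  map_one' := rfl
  map_mul' _ _ := rfl

@[simp] lemma conjDer_apply (σ : ContAut F L) (D : Der F L) (x : L) :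
    (((conjDer σ : ContAut F (Der F L)) : Der F L ≃ₗ[F] Der F L) D).1 x =
      σ.1 (D.1 (σ.1.symm x)) := rfl

end Der

/-! ### Filtrations and the associated graded Lie superalgebra -/

/-- A filtration `L = S_{-d} ⊇ S_{-d+1} ⊇ ⋯ ⊇ S_0 ⊇ S_1 ⊇ ⋯` of a topological Lie superalgebra by
open super-subspaces, with `[S_i, S_j] ⊆ S_{i+j}` (so that `S_j` is a subalgebra for `j ≥ 0`) and
`⋂ S_j = 0`. It is indexed by all integers, with `S_j = L` for `j ≤ -d`. -/
structure Filtration (F : Type*) (L : Type*) [Field F] [AddCommGroup L] [Module F L]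
    [LieSuperalgebra F L] [TopologicalSpace L] where
  toFun : ℤ → Submodule F L
  antitone : Antitone toFun
  isOpen : ∀ j, IsOpen (toFun j : Set L)
  isSuperSubspace : ∀ j, IsSuperSubspace F (toFun j)
  bracket_mem : ∀ {i j : ℤ} {x y : L}, x ∈ toFun i → y ∈ toFun j → br F x y ∈ toFun (i + j)
  exists_depth : ∃ d : ℕ, toFun (-(d : ℤ)) = ⊤
  iInf_eq_bot : ⨅ j, toFun j = ⊥

namespace Filtration

variable {F} [TopologicalSpace L]

instance : CoeFun (Filtration F L) fun _ => ℤ → Submodule F L := ⟨toFun⟩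

/-- The members of the filtration are invariant under all continuous automorphisms. -/
def IsInvariant (S : Filtration F L) : Prop :=
  ∀ g ∈ ContAut F L, ∀ j, ∀ x ∈ S j, g x ∈ S j

variable (S : Filtration F L)

/-- The space `𝔤_j = S_j / S_{j+1}`. -/
def GrComp (j : ℤ) : Type _ := S j ⧸ (S (j + 1)).submoduleOf (S j)

instance (j : ℤ) : AddCommGroup (S.GrComp j) :=
  inferInstanceAs (AddCommGroup (S j ⧸ (S (j + 1)).submoduleOf (S j)))

instance (j : ℤ) : Module F (S.GrComp j) :=
  inferInstanceAs (Module F (S j ⧸ (S (j + 1)).submoduleOf (S j)))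

/-- The quotient map `S_j → 𝔤_j`. -/
def grMk (j : ℤ) : S j →ₗ[F] S.GrComp j := ((S (j + 1)).submoduleOf (S j)).mkQ

lemma grMk_surjective (j : ℤ) : Function.Surjective (S.grMk j) := Submodule.mkQ_surjective _

lemma grMk_eq_zero_iff {j : ℤ} (x : S j) : S.grMk j x = 0 ↔ x.1 ∈ S (j + 1) :=
  Submodule.Quotient.mk_eq_zero ((S (j + 1)).submoduleOf (S j))

/-- The linear map `𝔤_j → M` induced by a linear map `S_j → M` that vanishes on `S_{j+1}`. -/
def grLift {M : Type*} [AddCommGroup M] [Module F M] (j : ℤ) (f : S j →ₗ[F] M)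
    (hf : ∀ x : S j, x.1 ∈ S (j + 1) → f x = 0) : S.GrComp j →ₗ[F] M :=
  Submodule.liftQ ((S (j + 1)).submoduleOf (S j)) f hf

lemma grLift_grMk {M : Type*} [AddCommGroup M] [Module F M] (j : ℤ) (f : S j →ₗ[F] M)
    (hf : ∀ x : S j, x.1 ∈ S (j + 1) → f x = 0) (x : S j) : S.grLift j f hf (S.grMk j x) = f x :=
  rfl

/-- The space `Gr L = ⨁ 𝔤_j`. -/
abbrev Gr : Type _ := DirectSum ℤ S.GrComp

/-- The class in `𝔤_j ⊆ Gr L` of an element of `S_j`. -/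
def symb (j : ℤ) : S j →ₗ[F] S.Gr :=
  DirectSum.lof F ℤ S.GrComp j ∘ₗ S.grMk j

/-- The bracket `𝔤_i × 𝔤_j → 𝔤_{i+j}`. -/
def grCompBracket (i j : ℤ) : S.GrComp i →ₗ[F] S.GrComp j →ₗ[F] S.GrComp (i + j) :=
  (S.grLift j (S.grLift i
    (LinearMap.mk₂ F (fun (x : S i) (y : S j) =>
      S.grMk (i + j) ⟨br F x.1 y.1, S.bracket_mem x.2 y.2⟩)
      (fun _ _ _ => by rw [← map_add]; exact congrArg _ (Subtype.ext (by simp [br])))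
      (fun _ _ _ => by rw [← map_smul]; exact congrArg _ (Subtype.ext (by simp [br])))
      (fun _ _ _ => by rw [← map_add]; exact congrArg _ (Subtype.ext (by simp [br])))
      (fun _ _ _ => by rw [← map_smul]; exact congrArg _ (Subtype.ext (by simp [br]))))
    (fun x hx => LinearMap.ext fun y => (S.grMk_eq_zero_iff _).2 (by
      have := S.bracket_mem (i := i + 1) (j := j) hx y.2
      rwa [add_right_comm] at this))).flip
    (fun y hy => LinearMap.ext fun x => by
      obtain ⟨x, rfl⟩ := S.grMk_surjective _ x
      refine (S.grMk_eq_zero_iff _).2 ?_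
      have := S.bracket_mem (i := i) (j := j + 1) x.2 hy
      rwa [← add_assoc] at this)).flip

/-- The bracket of `Gr L`. -/
def grBracket : S.Gr →ₗ[F] S.Gr →ₗ[F] S.Gr :=
  DirectSum.toModule F ℤ (S.Gr →ₗ[F] S.Gr) fun i =>
    (DirectSum.toModule F ℤ (S.GrComp i →ₗ[F] S.Gr) fun j =>
      ((S.grCompBracket i j).compr₂ (DirectSum.lof F ℤ S.GrComp (i + j))).flip).flip

lemma grBracket_symb {i j : ℤ} (x : S i) (y : S j) :
    S.grBracket (S.symb i x) (S.symb j y) =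
      S.symb (i + j) ⟨br F x.1 y.1, S.bracket_mem x.2 y.2⟩ := by
  simp only [grBracket, symb, LinearMap.comp_apply, DirectSum.toModule_lof, LinearMap.flip_apply]
  rfl

lemma symb_congr {i j : ℤ} (h : i = j) {x : L} (hx : x ∈ S i) (hx' : x ∈ S j) :
    S.symb i ⟨x, hx⟩ = S.symb j ⟨x, hx'⟩ := by
  subst h; rfl

/-- The even and odd parts of `𝔤_j`. -/
def grCompParity (j : ℤ) (p : ZMod 2) : Submodule F (S.GrComp j) :=
  ((parity p).submoduleOf (S j)).map (S.grMk j)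

lemma isCompl_grCompParity (j : ℤ) : IsCompl (S.grCompParity j 0) (S.grCompParity j 1) := by
  constructor
  · rw [Submodule.disjoint_def]
    rintro _ ⟨a, ha, rfl⟩ ⟨b, hb, hab⟩
    refine (S.grMk_eq_zero_iff _).2 ?_
    have h : b.1 - a.1 ∈ S (j + 1) := by
      rw [← sub_eq_zero, ← map_sub] at hab
      exact (S.grMk_eq_zero_iff _).1 hab
    obtain ⟨u, ⟨hu, hu0⟩, v, ⟨hv, hv1⟩, huv⟩ := Submodule.mem_sup.1 (S.isSuperSubspace _ h)
    have : a.1 = -u := by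
      have h1 : a.1 + u = b.1 - v := by
        rw [eq_sub_iff_add_eq, add_assoc, huv, add_sub_cancel]
      have h2 : a.1 + u ∈ parity (F := F) (L := L) 0 := add_mem ha hu0
      have h3 : a.1 + u ∈ parity (F := F) (L := L) 1 := h1 ▸ sub_mem hb hv1
      exact eq_neg_of_add_eq_zero_left (eq_zero_of_parity F (by decide) h2 h3)
    rw [this]
    exact neg_mem hu
  · rw [codisjoint_iff_le_sup]
    intro z _
    obtain ⟨x, rfl⟩ := S.grMk_surjective _ z
    obtain ⟨u, ⟨hu, hu0⟩, v, ⟨hv, hv1⟩, huv⟩ := Submodule.mem_sup.1 (S.isSuperSubspace _ x.2)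
    have hx : x = ⟨u, hu⟩ + ⟨v, hv⟩ := Subtype.ext huv.symm
    rw [hx, map_add]
    exact add_mem (Submodule.mem_sup_left ⟨⟨u, hu⟩, hu0, rfl⟩)
      (Submodule.mem_sup_right ⟨⟨v, hv⟩, hv1, rfl⟩)

/-- The even and odd parts of `Gr L`. -/
def grParity (p : ZMod 2) : Submodule F S.Gr where
  carrier := {z | ∀ j, z j ∈ S.grCompParity j p}
  add_mem' := fun ha hb j => add_mem (ha j) (hb j)
  zero_mem' := fun _ => zero_mem _
  smul_mem' := fun c _ ha j => Submodule.smul_mem _ c (ha j)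

lemma lof_mem_grParity {p : ZMod 2} {j : ℤ} {a : S.GrComp j} (ha : a ∈ S.grCompParity j p) :
    DirectSum.lof F ℤ S.GrComp j a ∈ S.grParity p := fun k => by
  by_cases h : j = k
  · subst h
    rwa [DirectSum.lof_apply]
  · rw [DirectSum.lof_eq_of, DirectSum.of_eq_of_ne _ _ _ (Ne.symm h)]
    exact zero_mem _

lemma symb_mem_grParity {p : ZMod 2} {j : ℤ} {x : S j} (hx : x.1 ∈ parity (F := F) (L := L) p) :
    S.symb j x ∈ S.grParity p :=
  S.lof_mem_grParity ⟨x, hx, rfl⟩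

/-- Elements of `Gr L` of parity `p` are spanned by the classes of elements of parity `p`. -/
lemma grParity_induction {p : ZMod 2} {P : ∀ z : S.Gr, z ∈ S.grParity p → Prop}
    (h0 : P 0 (zero_mem _))
    (hadd : ∀ a b ha hb, P a ha → P b hb → P (a + b) (add_mem ha hb))
    (hsymb : ∀ (j : ℤ) (x : S j) (hx : x.1 ∈ parity (F := F) (L := L) p),
      P (S.symb j x) (S.symb_mem_grParity hx))
    {z : S.Gr} (hz : z ∈ S.grParity p) : P z hz := by
  classical
  have key : ∃ h, P z h := by
    rw [← DirectSum.sum_support_of z]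
    refine Finset.sum_induction _ (fun z => ∃ h, P z h) ?_ ⟨_, h0⟩ fun j _ => ?_
    · rintro a b ⟨ha, ha'⟩ ⟨hb, hb'⟩
      exact ⟨_, hadd a b ha hb ha' hb'⟩
    · obtain ⟨x, hx, hxz⟩ := hz j
      rw [← hxz]
      exact ⟨_, hsymb j x hx⟩
  exact key.2

/-- `Gr L` is a Lie superalgebra. -/
instance instLieSuperalgebraGr : LieSuperalgebra F S.Gr where
  parity := S.grParity
  isCompl_parity := by
    constructor
    · rw [Submodule.disjoint_def]
      intro z h0 h1
      exact DFinsupp.ext fun j =>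
        (Submodule.disjoint_def.1 (S.isCompl_grCompParity j).disjoint) _ (h0 j) (h1 j)
    · rw [codisjoint_iff_le_sup]
      intro z _
      induction z using DirectSum.induction_on with
      | zero => exact zero_mem _
      | add a b ha hb => exact add_mem (ha trivial) (hb trivial)
      | of j a =>
        have h : a ∈ S.grCompParity j 0 ⊔ S.grCompParity j 1 := by
          rw [(S.isCompl_grCompParity j).sup_eq_top]; trivial
        obtain ⟨u, hu, v, hv, rfl⟩ := Submodule.mem_sup.1 h
        rw [map_add]
        exact add_mem (Submodule.mem_sup_left (S.lof_mem_grParity hu))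
          (Submodule.mem_sup_right (S.lof_mem_grParity hv))
  bracket := S.grBracket
  bracket_mem := by
    intro p q x y hx hy
    induction hx using S.grParity_induction with
    | h0 => simp
    | hadd a b _ _ ha hb => rw [map_add]; exact add_mem ha hb
    | hsymb i x hx =>
      induction hy using S.grParity_induction with
      | h0 => simp
      | hadd a b _ _ ha hb => rw [map_add]; exact add_mem ha hb
      | hsymb j y hy =>
        rw [S.grBracket_symb]
        exact S.symb_mem_grParity (LieSuperalgebra.bracket_mem hx hy)
  skew := by
    intro p q x y hx hy
    induction hx using S.grParity_induction with
    | h0 => simp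
    | hadd a b _ _ ha hb => rw [map_add, map_add, LinearMap.add_apply, ha, hb, smul_add]; abel
    | hsymb i x hx =>
      induction hy using S.grParity_induction with
      | h0 => simp
      | hadd a b _ _ ha hb => rw [map_add, map_add, LinearMap.add_apply, ha, hb, smul_add]; abel
      | hsymb j y hy =>
        rw [S.grBracket_symb, S.grBracket_symb,
          S.symb_congr (add_comm j i) _ (add_comm i j ▸ S.bracket_mem y.2 x.2), ← map_smul, ← map_neg]
        exact congrArg _ (Subtype.ext (skew hx hy))
  jacobi := by
    intro p q r x y z hx hy hz
    induction hx using S.grParity_induction with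
    | h0 => simp
    | hadd a b _ _ ha hb => simp only [map_add, LinearMap.add_apply, ha, hb, smul_add]; abel
    | hsymb i x hx =>
      induction hy using S.grParity_induction with
      | h0 => simp
      | hadd a b _ _ ha hb => simp only [map_add, LinearMap.add_apply, ha, hb, smul_add]; abel
      | hsymb j y hy =>
        induction hz using S.grParity_induction with
        | h0 => simp
        | hadd a b _ _ ha hb => simp only [map_add, ha, hb, smul_add]; abel
        | hsymb k z hz =>
          simp only [S.grBracket_symb]
          rw [S.symb_congr (add_assoc i j k) _
              (add_assoc i j k ▸ S.bracket_mem (S.bracket_mem x.2 y.2) z.2),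
            S.symb_congr (add_left_comm j i k) _
              (add_left_comm j i k ▸ S.bracket_mem y.2 (S.bracket_mem x.2 z.2)),
            ← map_smul, ← map_add]
          exact congrArg _ (Subtype.ext (jacobi hx hy hz))

/-- The subspace `𝔤_j` of `Gr L`. -/
def grPiece (j : ℤ) : Submodule F S.Gr := LinearMap.range (DirectSum.lof F ℤ S.GrComp j)

/-- The group `Aut (Gr L)` of automorphisms of `Gr L` that preserve the grading. -/
def AutGr : Subgroup (S.Gr ≃ₗ[F] S.Gr) where
  carrier := {φ | φ ∈ Aut F S.Gr ∧ ∀ j z, φ z ∈ S.grPiece j ↔ z ∈ S.grPiece j}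
  mul_mem' := by
    rintro a b ⟨ha, ha'⟩ ⟨hb, hb'⟩
    exact ⟨mul_mem ha hb, fun j z => (ha' j _).trans (hb' j z)⟩
  one_mem' := ⟨one_mem _, fun _ _ => Iff.rfl⟩
  inv_mem' := by
    rintro a ⟨ha, ha'⟩
    have key : ∀ x, a (a⁻¹ x) = x := fun x => a.apply_symm_apply x
    exact ⟨inv_mem ha, fun j z => by rw [← ha', key]⟩

/-- The restriction map from `Aut (Gr L)` to the group of linear automorphisms of `𝔤_j`. -/
def restrictPiece (j : ℤ) : S.AutGr →* (S.grPiece j ≃ₗ[F] S.grPiece j) where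
  toFun φ := φ.1.ofSubmodules (S.grPiece j) (S.grPiece j) (by
    ext z
    refine ⟨?_, fun hz => ⟨φ.1.symm z, ?_, φ.1.apply_symm_apply z⟩⟩
    · rintro ⟨w, hw, rfl⟩
      exact (φ.2.2 j w).2 hw
    · exact (φ.2.2 j _).1 (by simpa using hz))
  map_one' := rfl
  map_mul' _ _ := rfl

/-- The linear map of `Gr L` induced by a continuous automorphism of `L`. -/
def grMap (hS : S.IsInvariant) (g : ContAut F L) : S.Gr →ₗ[F] S.Gr :=
  DirectSum.lmap fun j => S.grLift j
    (S.grMk j ∘ₗ (g.1 : L →ₗ[F] L).restrict (p := S j) (q := S j) (hS g.1 g.2 j))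
    (fun x hx => (S.grMk_eq_zero_iff _).2 (hS g.1 g.2 (j + 1) x.1 hx))

lemma grMap_symb (hS : S.IsInvariant) (g : ContAut F L) (j : ℤ) (x : S j) :
    S.grMap hS g (S.symb j x) = S.symb j ⟨g.1 x.1, hS g.1 g.2 j x.1 x.2⟩ :=
  DirectSum.lmap_lof _ _ _

lemma gr_induction {P : S.Gr → Prop} (h0 : P 0)
    (hadd : ∀ a b, P a → P b → P (a + b)) (hsymb : ∀ (j : ℤ) (x : S j), P (S.symb j x))
    (z : S.Gr) : P z := by
  induction z using DirectSum.induction_on with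
  | zero => exact h0
  | add a b ha hb => exact hadd a b ha hb
  | of j a =>
    obtain ⟨x, rfl⟩ := S.grMk_surjective _ a
    exact hsymb j x

lemma grMap_mul (hS : S.IsInvariant) (g h : ContAut F L) (z : S.Gr) :
    S.grMap hS (g * h) z = S.grMap hS g (S.grMap hS h z) := by
  induction z using S.gr_induction with
  | h0 => simp
  | hadd a b ha hb => rw [map_add, ha, hb, map_add, map_add]
  | hsymb j x => simp only [grMap_symb]; rfl

lemma grMap_one (hS : S.IsInvariant) (z : S.Gr) : S.grMap hS 1 z = z := by
  induction z using S.gr_induction with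
  | h0 => simp
  | hadd a b ha hb => rw [map_add, ha, hb]
  | hsymb j x => simp only [grMap_symb]; rfl

/-- The linear automorphism of `Gr L` induced by a continuous automorphism of `L`. -/
def grEquiv (hS : S.IsInvariant) (g : ContAut F L) : S.Gr ≃ₗ[F] S.Gr :=
  LinearEquiv.ofLinearMap (S.grMap hS g) (S.grMap hS g⁻¹)
    (LinearMap.ext fun z => by
      rw [LinearMap.comp_apply, ← grMap_mul, mul_inv_cancel, grMap_one, LinearMap.id_apply])
    (LinearMap.ext fun z => by
      rw [LinearMap.comp_apply, ← grMap_mul, inv_mul_cancel, grMap_one, LinearMap.id_apply])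

lemma grMap_mem_grParity (hS : S.IsInvariant) (g : ContAut F L) {p : ZMod 2} {z : S.Gr}
    (hz : z ∈ S.grParity p) : S.grMap hS g z ∈ S.grParity p := by
  induction hz using S.grParity_induction with
  | h0 => simp
  | hadd a b _ _ ha hb => rw [map_add]; exact add_mem ha hb
  | hsymb j x hx =>
    rw [grMap_symb]
    exact S.symb_mem_grParity ((g.2.1.1 p x.1).2 hx)

lemma grMap_mem_grPiece (hS : S.IsInvariant) (g : ContAut F L) {j : ℤ} {z : S.Gr}
    (hz : z ∈ S.grPiece j) : S.grMap hS g z ∈ S.grPiece j := by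
  obtain ⟨a, rfl⟩ := hz
  exact ⟨_, (DirectSum.lmap_lof _ _ _).symm⟩

lemma grMap_bracket (hS : S.IsInvariant) (g : ContAut F L) (z w : S.Gr) :
    S.grMap hS g (S.grBracket z w) = S.grBracket (S.grMap hS g z) (S.grMap hS g w) := by
  induction z using S.gr_induction with
  | h0 => simp
  | hadd a b ha hb => simp only [map_add, LinearMap.add_apply, ha, hb]
  | hsymb i x =>
    induction w using S.gr_induction with
    | h0 => simp
    | hadd a b ha hb => simp only [map_add, ha, hb]
    | hsymb j y =>
      simp only [grMap_symb, grBracket_symb]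
      exact congrArg _ (Subtype.ext (g.2.1.2 x.1 y.1))

lemma grEquiv_mem (hS : S.IsInvariant) (g : ContAut F L) : S.grEquiv hS g ∈ S.AutGr := by
  have key : ∀ z, S.grMap hS g⁻¹ (S.grMap hS g z) = z := fun z => by
    rw [← grMap_mul, inv_mul_cancel, grMap_one]
  refine ⟨⟨fun p z => ⟨fun h => ?_, S.grMap_mem_grParity hS g⟩, S.grMap_bracket hS g⟩,
    fun j z => ⟨fun h => ?_, S.grMap_mem_grPiece hS g⟩⟩
  · have := S.grMap_mem_grParity hS g⁻¹ h
    rwa [← key z]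
  · have := S.grMap_mem_grPiece hS g⁻¹ h
    rwa [← key z]

/-- The homomorphism `Aut L → Aut (Gr L)`, for an invariant filtration. -/
def toAutGr (hS : S.IsInvariant) : ContAut F L →* S.AutGr where
  toFun g := ⟨S.grEquiv hS g, S.grEquiv_mem hS g⟩
  map_one' := Subtype.ext (LinearEquiv.ext fun z => S.grMap_one hS z)
  map_mul' g h := Subtype.ext (LinearEquiv.ext fun z => S.grMap_mul hS g h z)

lemma toAutGr_symb (hS : S.IsInvariant) (g : ContAut F L) (j : ℤ) (x : S j) :
    (S.toAutGr hS g).1 (S.symb j x) = S.symb j ⟨g.1 x.1, hS g.1 g.2 j x.1 x.2⟩ :=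
  S.grMap_symb hS g j x

/-- The group `Autf L` of the continuous automorphisms of `L` that induce the identity
automorphism of `Gr L`. -/
abbrev Autf (hS : S.IsInvariant) : Subgroup (ContAut F L) := (S.toAutGr hS).ker

/-- The group `Autgr L` of the automorphisms of `Gr L` induced by continuous automorphisms
of `L`. -/
abbrev Autgr (hS : S.IsInvariant) : Subgroup S.AutGr := (S.toAutGr hS).range

/-- Transitivity of the graded Lie superalgebra `Gr L = ⨁ 𝔤_j`: an element of `𝔤_j`, `j ≥ 0`, that
commutes with `𝔤_{-1}` is zero, and `𝔤_{-n} = (𝔤_{-1})^n` for all `n ≥ 1`. -/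
structure IsTransitive : Prop where
  eq_zero : ∀ j : ℤ, 0 ≤ j → ∀ z ∈ S.grPiece j,
    (∀ w ∈ S.grPiece (-1), br F z w = 0) → z = 0
  generated : ∀ n : ℕ, 1 ≤ n → S.grPiece (-((n : ℤ) + 1)) =
    Submodule.span F {z | ∃ u ∈ S.grPiece (-1), ∃ w ∈ S.grPiece (-(n : ℤ)), z = br F u w}

/-- The members `(Der L)_k = {D | D S_j ⊆ S_{j+k} for all j}` of the filtration of `Der L` induced
by the filtration of `L`. -/
def derFiltration [IsTopologicalAddGroup L] [IsLinearTopology F L] (k : ℤ) :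
    Submodule F (Der F L) where
  carrier := {D | ∀ j, ∀ x ∈ S j, D.1 x ∈ S (j + k)}
  add_mem' := fun ha hb j x hx => add_mem (ha j x hx) (hb j x hx)
  zero_mem' := fun _ _ _ => zero_mem _
  smul_mem' := fun c _ ha j x hx => Submodule.smul_mem _ c (ha j x hx)

/-- The super-subspaces `𝔤_j` of `L` satisfy `S_j = 𝔤_j ⊕ S_{j+1}` and `[𝔤_i, 𝔤_j] ⊆ 𝔤_{i+j}`. -/
structure IsGradedBy (𝔤 : ℤ → Submodule F L) : Prop where
  isSuperSubspace : ∀ j, IsSuperSubspace F (𝔤 j)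
  sup_eq : ∀ j, 𝔤 j ⊔ S (j + 1) = S j
  inf_eq : ∀ j, 𝔤 j ⊓ S (j + 1) = ⊥
  bracket_mem : ∀ {i j : ℤ} {x y : L}, x ∈ 𝔤 i → y ∈ 𝔤 j → br F x y ∈ 𝔤 (i + j)

lemma IsGradedBy.le {S : Filtration F L} {𝔤 : ℤ → Submodule F L} (h : S.IsGradedBy 𝔤) (j : ℤ) :
    𝔤 j ≤ S j :=
  le_sup_left.trans (h.sup_eq j).le

end Filtration

end LieSuperalgebra

end

noncomputable section

namespace LieSuperalgebra

/-! Everything takes place among the operators on `L` that raise the degree of the filtration by a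
fixed amount (`raise`). Linear compactness makes the quotients of `L` by open subspaces
finite-dimensional, and a Chevalley-type argument then shows that the `S j` form a basis of
neighbourhoods of `0` (`hasBasis_nhds_zero`). Hence bounded-degree operators are continuous, and a
series of operators whose `k`-th term raises the degree by `k` has a unique sum
(`exists_end_of_mem_raise`, `eq_of_forall_sub_mem_raise`).

(a) An automorphism of `Gr L` fixing `𝔤_{-1}` fixes the negative part because `𝔤_{-1}` generates it.
It fixes `z` of degree `j ≥ 0` by induction on `j`: the difference `φ z - z` commutes with `𝔤_{-1}`,
so it vanishes by transitivity.

(b) An automorphism `σ` lies in `Autf L` exactly when `σ - 1` raises the degree by `1`. For an even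
derivation `D` raising the degree by `1`, `exp D` is such an automorphism, with inverse `exp (-D)`.
Conversely, the binomial series `σ ^ n = ∑ (n choose k) (σ - 1) ^ k` can be regrouped by powers of
`n` as `σ ^ n = ∑ n ^ j E_j`, because binomial coefficients are polynomials in `n`. In
characteristic `0` such coefficients are determined by the values at natural `n`. Comparing them in
`σ ^ (n + m) = σ ^ n σ ^ m` gives `E_j = E_1 ^ j / j!`, so `σ = exp E_1`. Comparing them in `σ ^ n
[x, y] = [σ ^ n x, σ ^ n y]` shows that `E_1` is a derivation. Thus `E_1 = log σ` is obtained
without manipulating the logarithmic series. On `Der L`, `ad D` is the sum of the commuting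
operators of left multiplication by `D` and right multiplication by `-D`, so `exp (ad D)` is
conjugation by `exp D`.

(c) With a grading, the sum of the `𝔤_j` is dense, so a bounded-degree operator is determined by its
values on the `𝔤_j` (`IsGradedBy.end_ext`). An automorphism of `Gr L` is transported to the `𝔤_j`
and summed to an operator on `L`. Multiplicativity and compatibility with parity and bracket need
only be checked on homogeneous elements. This gives a section, hence the semidirect product. -/

lemma isClosed_mk'_of_isOpen {F L : Type*} [Field F] [AddCommGroup L] [Module F L]
    [TopologicalSpace L] [IsTopologicalAddGroup L] (p : L) {W : Submodule F L}
    (hW : IsOpen (W : Set L)) : IsClosed (AffineSubspace.mk' p W : Set L) := by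
  have h : IsClosed (W : Set L) := W.toAddSubgroup.isClosed_of_isOpen hW
  have : (AffineSubspace.mk' p W : Set L) = (fun x => x - p) ⁻¹' (W : Set L) := by
    ext x
    simp [AffineSubspace.mem_mk']
  rw [this]
  exact h.preimage (continuous_id.sub continuous_const)

variable {F L : Type*} [Field F] [AddCommGroup L] [Module F L] [LieSuperalgebra F L]
  [TopologicalSpace L]

/-! ### Linear compactness -/

namespace IsLinearlyCompact

variable [IsTopologicalAddGroup L]

/-- The form in which linear compactness is used: a Chinese-remainder principle for congruences
modulo open subspaces. It serves below as completeness. -/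
lemma exists_forall_sub_mem (hL : IsLinearlyCompact F L) {ι : Type*} (p : ι → L)
    (W : ι → Submodule F L) (hW : ∀ i, IsOpen (W i : Set L))
    (h : ∀ t : Finset ι, ∃ x, ∀ i ∈ t, x - p i ∈ W i) : ∃ x, ∀ i, x - p i ∈ W i := by
  classical
  obtain ⟨x, hx⟩ := hL.inter_nonempty (Set.range fun i => AffineSubspace.mk' (p i) (W i))
    (by rintro _ ⟨i, rfl⟩; exact isClosed_mk'_of_isOpen _ (hW i))
    (fun t ht => by
      choose f hf using fun A : t => ht A.2
      obtain ⟨x, hx⟩ := h (Finset.univ.image f)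
      refine ⟨x, Set.mem_iInter₂.2 fun A hA => ?_⟩
      have := hx (f ⟨A, hA⟩) (by simp)
      have h2 := hf ⟨A, hA⟩
      dsimp only at h2
      rw [← h2]
      simpa [AffineSubspace.mem_mk'] using this)
  refine ⟨x, fun i => ?_⟩
  have := Set.mem_iInter₂.1 hx _ ⟨i, rfl⟩
  simpa [AffineSubspace.mem_mk'] using this

lemma finite_quotient (hL : IsLinearlyCompact F L) {U : Submodule F L}
    (hU : IsOpen (U : Set L)) : Module.Finite F (L ⧸ U) := by
  classical
  let b := Module.Basis.ofVectorSpace F (L ⧸ U)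
  choose p hp using fun i => U.mkQ_surjective (b i)
  -- Ask for `x` whose class in `L ⧸ U` has every coordinate equal to `1`. Finitely many of these
  -- conditions are met by a finite sum of lifts of basis vectors; meeting all of them forces the
  -- basis to be finite, since a vector has finite support.
  obtain ⟨x, hx⟩ := hL.exists_forall_sub_mem p (fun i => LinearMap.ker (b.coord i ∘ₗ U.mkQ))
    (fun i => Submodule.isOpen_mono (fun u hu => by
      rw [LinearMap.mem_ker, LinearMap.comp_apply, Submodule.mkQ_apply,
        (Submodule.Quotient.mk_eq_zero U).2 hu, map_zero]) hU)
    (fun t => ⟨∑ i ∈ t, p i, fun i hi => by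
      rw [LinearMap.mem_ker, LinearMap.comp_apply, map_sub, map_sum, map_sub, hp]
      simp only [hp, map_sum, Module.Basis.coord_apply, Module.Basis.repr_self]
      simp [Finsupp.single_apply, hi]⟩)
  have hx' : ∀ i, b.repr (U.mkQ x) i = 1 := fun i => by
    have := hx i
    rw [LinearMap.mem_ker, LinearMap.comp_apply, map_sub, hp, map_sub, sub_eq_zero] at this
    simpa using this
  have : Finite (Module.Basis.ofVectorSpaceIndex F (L ⧸ U)) :=
    Set.finite_univ_iff.1 <| (b.repr (U.mkQ x)).support.finite_toSet.subset fun i _ => by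
      rw [Finset.mem_coe, Finsupp.mem_support_iff, hx' i]
      exact one_ne_zero
  exact Module.Finite.of_basis b

end IsLinearlyCompact

/-! ### The filtration topology and operators of bounded degree -/

namespace Filtration

variable (S : Filtration F L)

lemma eq_zero_of_forall_mem {x : L} (d : ℤ) (h : ∀ K : ℕ, x ∈ S (K - d)) : x = 0 := by
  rw [← Submodule.mem_bot F, ← S.iInf_eq_bot, Submodule.mem_iInf]
  exact fun j => S.antitone (by lia) (h (j + d).toNat)

/-- Chevalley's argument. The images of the `S n` in the finite-dimensional space `L ⧸ U` stabilise.
An element `x` of the stable term is therefore congruent modulo `U` to some `y m` in every `S m`.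
Linear compactness glues the `y m` to one `z` that is congruent to `x` modulo `U` and lies in all `S
m`; then `z = 0`, so `x ∈ U`. -/
lemma exists_le_of_isOpen [IsTopologicalAddGroup L] (hL : IsLinearlyCompact F L)
    {U : Submodule F L} (hU : IsOpen (U : Set L)) : ∃ j, S j ≤ U := by
  have := hL.finite_quotient hU
  obtain ⟨n, hn⟩ := IsArtinian.monotone_stabilizes (R := F) (M := L ⧸ U)
    ⟨fun n : ℕ => OrderDual.toDual ((S (n : ℤ)).map U.mkQ), fun a b hab =>
      Submodule.map_mono (S.antitone (Int.ofNat_le.2 hab))⟩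
  refine ⟨n, fun x hx => ?_⟩
  have key : ∀ m : ℕ, ∃ y ∈ S (m : ℤ), y - x ∈ U := fun m => by
    rcases le_total n m with h | h
    · have h1 : (S (n : ℤ)).map U.mkQ = (S (m : ℤ)).map U.mkQ := hn m h
      obtain ⟨y, hy, hyx⟩ := h1 ▸ Submodule.mem_map_of_mem (f := U.mkQ) hx
      exact ⟨y, hy, (Submodule.Quotient.eq U).1 hyx⟩
    · exact ⟨x, S.antitone (Int.ofNat_le.2 h) hx, by simp⟩
  choose y hy hyx using key
  obtain ⟨z, hz⟩ := hL.exists_forall_sub_mem y (fun m : ℕ => U ⊓ S (m : ℤ))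
    (fun m => hU.inter (S.isOpen m)) (fun t => ⟨y (t.sup id), fun m hm =>
      ⟨by simpa using sub_mem (hyx (t.sup id)) (hyx m),
        sub_mem (S.antitone (Int.ofNat_le.2 (Finset.le_sup (f := id) hm)) (hy _)) (hy m)⟩⟩)
  have h0 : z = 0 := S.eq_zero_of_forall_mem 0 fun m => by
    simpa using add_mem (hz m).2 (hy m)
  have h1 := (hz 0).1
  rw [h0] at h1
  have := neg_mem (add_mem h1 (hyx 0))
  simpa using this

lemma hasBasis_nhds_zero [IsTopologicalAddGroup L] [IsLinearTopology F L]
    (hL : IsLinearlyCompact F L) :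
    (𝓝 (0 : L)).HasBasis (fun _ : ℤ => True) fun j => (S j : Set L) := by
  refine ⟨fun t => ⟨fun ht => ?_, fun ⟨j, _, hj⟩ =>
    mem_of_superset ((S.isOpen j).mem_nhds (zero_mem _)) hj⟩⟩
  obtain ⟨U, hU, hUt⟩ := (IsLinearTopology.hasBasis_open_submodule F).mem_iff.1 ht
  obtain ⟨j, hj⟩ := S.exists_le_of_isOpen hL hU
  exact ⟨j, trivial, (SetLike.coe_subset_coe.2 hj).trans hUt⟩

/-- The linear operators on `L` that raise the degree of the filtration by `k`. -/
def raise (k : ℤ) : Submodule F (Module.End F L) where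
  carrier := {T | ∀ j, ∀ x ∈ S j, T x ∈ S (j + k)}
  add_mem' := fun ha hb j x hx => add_mem (ha j x hx) (hb j x hx)
  zero_mem' := fun _ _ _ => zero_mem _
  smul_mem' := fun c _ ha j x hx => Submodule.smul_mem _ c (ha j x hx)

variable {S}

lemma raise_mono {k l : ℤ} (h : k ≤ l) : S.raise l ≤ S.raise k :=
  fun _ hT j x hx => S.antitone (by lia) (hT j x hx)

lemma mul_mem_raise {A B : Module.End F L} {k l m : ℤ} (hA : A ∈ S.raise k)
    (hB : B ∈ S.raise l) (h : m ≤ k + l) : A * B ∈ S.raise m :=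
  fun j x hx => S.antitone (by lia) (hA _ _ (hB j x hx))

lemma one_mem_raise : (1 : Module.End F L) ∈ S.raise 0 := fun j x hx => by
  rw [add_zero]; exact hx

lemma pow_mem_raise {A : Module.End F L} (hA : A ∈ S.raise 1) (n : ℕ) : A ^ n ∈ S.raise n := by
  induction n with
  | zero => exact one_mem_raise
  | succ n ih => rw [pow_succ]; exact mul_mem_raise ih hA (by push_cast; lia)

lemma eq_of_forall_sub_mem_raise {A B : Module.End F L} (h : ∀ K : ℕ, A - B ∈ S.raise K) :
    A = B := by
  obtain ⟨d, hd⟩ := S.exists_depth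
  refine LinearMap.ext fun x => sub_eq_zero.1 (S.eq_zero_of_forall_mem d fun K => ?_)
  have := h K (-d) x (hd ▸ trivial)
  rwa [neg_add_eq_sub] at this

lemma proj_mem_raise (p : ZMod 2) : proj F p ∈ S.raise 0 := fun j x hx => by
  rw [add_zero]
  obtain ⟨u, ⟨hu, hu0⟩, v, ⟨hv, hv1⟩, rfl⟩ := Submodule.mem_sup.1 (S.isSuperSubspace _ hx)
  rw [map_add]
  obtain rfl | rfl := zmod_two p
  · rwa [proj_of_mem F hu0, proj_of_mem_ne F one_ne_zero hv1, add_zero]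
  · rwa [proj_of_mem F hv1, proj_of_mem_ne F zero_ne_one hu0, zero_add]

lemma continuous_of_mem_raise [IsTopologicalAddGroup L] [IsLinearTopology F L]
    (hL : IsLinearlyCompact F L) {T : Module.End F L} {k : ℤ} (hT : T ∈ S.raise k) :
    Continuous T := by
  refine continuous_of_continuousAt_zero T.toAddMonoidHom ?_
  rw [ContinuousAt, map_zero]
  refine ((S.hasBasis_nhds_zero hL).tendsto_iff (S.hasBasis_nhds_zero hL)).2 fun j _ =>
    ⟨j - k, trivial, fun x hx => ?_⟩
  simpa using hT _ x hx

/-- A series of operators whose images shrink converges. -/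
lemma exists_end_of_tails [IsTopologicalAddGroup L] (hL : IsLinearlyCompact F L) (d : ℤ)
    (u : ℕ → Module.End F L) (hu : ∀ (k : ℕ) x, u k x ∈ S (k - d)) :
    ∃ T : Module.End F L, ∀ K : ℕ, ∀ x, T x - ∑ k ∈ Finset.range K, u k x ∈ S (K - d) := by
  have tail : ∀ x, ∀ m n : ℕ, m ≤ n →
      ∑ k ∈ Finset.range n, u k x - ∑ k ∈ Finset.range m, u k x ∈ S (m - d) := fun x m n h => by
    rw [← Finset.sum_Ico_eq_sub _ h]
    exact sum_mem fun k hk => S.antitone (by have := (Finset.mem_Ico.1 hk).1; lia) (hu k x)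
  have ex : ∀ x, ∃ y, ∀ K : ℕ, y - ∑ k ∈ Finset.range K, u k x ∈ S (K - d) := fun x =>
    hL.exists_forall_sub_mem _ _ (fun K => S.isOpen _) fun t =>
      ⟨∑ k ∈ Finset.range (t.sup id), u k x, fun m hm => tail x _ _ (Finset.le_sup (f := id) hm)⟩
  choose T hT using ex
  -- The limits are chosen pointwise; linearity follows because a limit is unique, the `S j` having
  -- zero intersection.
  refine ⟨⟨⟨T, fun x y => sub_eq_zero.1 (S.eq_zero_of_forall_mem d fun K => ?_)⟩,
    fun c x => sub_eq_zero.1 (S.eq_zero_of_forall_mem d fun K => ?_)⟩, fun K x => hT x K⟩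
  · convert sub_mem (hT (x + y) K) (add_mem (hT x K) (hT y K)) using 1
    simp only [map_add, Finset.sum_add_distrib]
    abel
  · convert sub_mem (hT (c • x) K) (Submodule.smul_mem _ c (hT x K)) using 1
    simp only [map_smul, ← Finset.smul_sum, smul_sub, RingHom.id_apply]
    abel

/-- Pointwise convergence on `L = S (-d)` improves to an error estimate relative to every `S j`,
which is what allows limits to be multiplied. -/
lemma exists_end_of_mem_raise [IsTopologicalAddGroup L] (hL : IsLinearlyCompact F L)
    (u : ℕ → Module.End F L) (hu : ∀ k : ℕ, u k ∈ S.raise k) :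
    ∃ T : Module.End F L, ∀ K : ℕ, T - ∑ k ∈ Finset.range K, u k ∈ S.raise K := by
  obtain ⟨d, hd⟩ := S.exists_depth
  obtain ⟨T, hT⟩ := exists_end_of_tails hL (S := S) d u fun (k : ℕ) x => by
    have := hu k (-d) x (hd ▸ trivial)
    rwa [neg_add_eq_sub] at this
  refine ⟨T, fun K j x hx => ?_⟩
  -- The pointwise error after `N` terms is only known to lie in `S (N - d)`, so the sum is taken
  -- far enough for this to be inside `S (j + K)`. The added terms have index at least `K` and send
  -- `S j` into `S (j + K)`.
  have h1 := hT (K + (j + d).toNat) x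
  have h2 : ∑ k ∈ Finset.Ico K (K + (j + d).toNat), u k x ∈ S (j + K) := sum_mem fun k hk =>
    S.antitone (by have := (Finset.mem_Ico.1 hk).1; lia) (hu k j x hx)
  rw [Finset.sum_Ico_eq_sub _ (Nat.le_add_right _ _)] at h2
  have h3 := add_mem (S.antitone (show j + K ≤ _ by push_cast; lia) h1) h2
  simpa [LinearMap.sum_apply] using h3

end Filtration

end LieSuperalgebra

/-! ### Cauchy products, polynomial coefficients and exponential terms -/

namespace LieSuperalgebra

open Finset in
/-- A double sum over a triangle agrees with the sum over the square modulo the remaining terms. -/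
lemma sum_antidiagonal_sub_mem {F M : Type*} [Field F] [AddCommGroup M] [Module F M]
    (W : Submodule F M) (K : ℕ) (f : ℕ → ℕ → M) (hf : ∀ i j, K ≤ i + j → f i j ∈ W) :
    ∑ i ∈ range K, ∑ j ∈ range K, f i j -
      ∑ n ∈ range K, ∑ p ∈ antidiagonal n, f p.1 p.2 ∈ W := by
  simp_rw [Nat.sum_antidiagonal_eq_sum_range_succ f]
  rw [sum_range_diag_flip, ← sum_sub_distrib]
  refine sum_mem fun i hi => ?_
  rw [← sum_Ico_eq_sub _ (Nat.sub_le _ _)]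
  exact sum_mem fun j hj => hf i j (by have := (mem_Ico.1 hj).1; lia)

/-- The coefficients of a polynomial with values in a subspace at all natural numbers belong to this
subspace. -/
lemma mem_of_forall_sum_pow_smul_mem {F M : Type*} [Field F] [CharZero F] [AddCommGroup M]
    [Module F M] (W : Submodule F M) (J : ℕ) (v : ℕ → M)
    (h : ∀ n : ℕ, ∑ j ∈ Finset.range J, (n : F) ^ j • v j ∈ W) {j : ℕ} (hj : j < J) :
    v j ∈ W := by
  -- Linear functionals on `M ⧸ W` reduce the claim to a scalar polynomial, which vanishes at
  -- infinitely many points since the characteristic is `0`.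
  rw [← Submodule.Quotient.mk_eq_zero, ← Submodule.mkQ_apply, ← Module.forall_dual_apply_eq_zero_iff F]
  intro f
  let P : Polynomial F := ∑ j ∈ Finset.range J, Polynomial.monomial j (f (W.mkQ (v j)))
  have hP : P = 0 := by
    refine Polynomial.eq_zero_of_infinite_isRoot _
      ((Set.infinite_range_of_injective (Nat.cast_injective (R := F))).mono ?_)
    rintro _ ⟨n, rfl⟩
    have h1 := congrArg f ((Submodule.Quotient.mk_eq_zero W).2 (h n))
    rw [← Submodule.mkQ_apply, map_sum, map_sum, map_zero] at h1
    simp only [map_smul, smul_eq_mul] at h1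
    simp only [Set.mem_ofPred_eq, Polynomial.IsRoot, P, Polynomial.eval_finsetSum,
      Polynomial.eval_monomial]
    rw [← h1]
    exact Finset.sum_congr rfl fun _ _ => mul_comm _ _
  have := congrArg (fun Q => Polynomial.coeff Q j) hP
  simpa [P, Polynomial.finsetSum_coeff, Polynomial.coeff_monomial, hj] using this

section Factorial

variable {F : Type*} [Field F] [CharZero F]

/-- The term `T ^ n / n!` of the exponential series. -/
def expTerm {A : Type*} [Ring A] [Algebra F A] (T : A) (n : ℕ) : A :=
  ((n.factorial : F)⁻¹) • T ^ n

lemma succ_smul_expTerm {A : Type*} [Ring A] [Algebra F A] (T : A) (n : ℕ) :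
    ((n + 1 : ℕ) : F) • expTerm (F := F) T (n + 1) = T * expTerm (F := F) T n := by
  rw [expTerm, expTerm, smul_smul, mul_smul_comm, pow_succ', Nat.factorial_succ]
  congr 1
  have : ((n + 1 : ℕ) : F) ≠ 0 := Nat.cast_ne_zero.2 n.succ_ne_zero
  push_cast at this ⊢
  field_simp

lemma expTerm_add {A : Type*} [Ring A] [Algebra F A] {D D' : A} (hc : Commute D D') (n : ℕ) :
    expTerm (F := F) (D + D') n = ∑ p ∈ Finset.HasAntidiagonal.antidiagonal n,
      expTerm (F := F) D p.1 * expTerm (F := F) D' p.2 := by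
  rw [expTerm, hc.add_pow', Finset.smul_sum]
  refine Finset.sum_congr rfl fun p hp => ?_
  obtain rfl := Finset.HasAntidiagonal.mem_antidiagonal.1 hp
  rw [expTerm, expTerm, smul_mul_smul_comm, ← Nat.cast_smul_eq_nsmul F, smul_smul]
  congr 1
  have h := congrArg (Nat.cast (R := F)) (Nat.add_choose_mul_factorial_mul_factorial p.1 p.2)
  push_cast at h
  rw [← Nat.choose_symm_add] at h
  have h1 : ((p.1 + p.2).factorial : F) ≠ 0 := Nat.cast_ne_zero.2 (Nat.factorial_ne_zero _)
  have h2 : (p.1.factorial : F) ≠ 0 := Nat.cast_ne_zero.2 (Nat.factorial_ne_zero _)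
  have h3 : (p.2.factorial : F) ≠ 0 := Nat.cast_ne_zero.2 (Nat.factorial_ne_zero _)
  field_simp
  rw [mul_assoc] at h
  linear_combination h

/-- The binomial formula, for the powers of an operator that acts on products by the Leibniz
rule. -/
lemma expTerm_leibniz {V W U : Type*} [AddCommGroup V] [Module F V] [AddCommGroup W] [Module F W]
    [AddCommGroup U] [Module F U] (μ : V →ₗ[F] W →ₗ[F] U) (A : Module.End F V)
    (B : Module.End F W) (C : Module.End F U)
    (h : ∀ x y, C (μ x y) = μ (A x) y + μ x (B y)) (n : ℕ) (x : V) (y : W) :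
    expTerm (F := F) C n (μ x y) = ∑ p ∈ Finset.HasAntidiagonal.antidiagonal n,
      μ (expTerm (F := F) A p.1 x) (expTerm (F := F) B p.2 y) := by
  induction n with
  | zero => simp [expTerm]
  | succ n ih =>
    have hn : ((n + 1 : ℕ) : F) ≠ 0 := Nat.cast_ne_zero.2 n.succ_ne_zero
    refine smul_right_injective U hn ?_
    dsimp only
    have hA : ∀ (i : ℕ) x, A (expTerm (F := F) A i x) =
        ((i + 1 : ℕ) : F) • expTerm (F := F) A (i + 1) x := fun i x => by
      rw [← LinearMap.smul_apply, succ_smul_expTerm]; rfl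
    have hB : ∀ (i : ℕ) x, B (expTerm (F := F) B i x) =
        ((i + 1 : ℕ) : F) • expTerm (F := F) B (i + 1) x := fun i x => by
      rw [← LinearMap.smul_apply, succ_smul_expTerm]; rfl
    rw [← LinearMap.smul_apply, succ_smul_expTerm, Module.End.mul_apply, ih, map_sum]
    simp only [h, hA, hB]
    rw [Finset.sum_add_distrib, Finset.smul_sum]
    have e1 := Finset.Nat.sum_antidiagonal_succ (n := n) (f := fun p : ℕ × ℕ =>
      (p.1 : F) • μ (expTerm (F := F) A p.1 x) (expTerm (F := F) B p.2 y))
    have e2 := Finset.Nat.sum_antidiagonal_succ' (n := n) (f := fun p : ℕ × ℕ =>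
      (p.2 : F) • μ (expTerm (F := F) A p.1 x) (expTerm (F := F) B p.2 y))
    simp only [Nat.cast_zero, zero_smul, zero_add] at e1 e2
    simp only [map_smul, LinearMap.smul_apply]
    rw [← e1, ← e2, ← Finset.sum_add_distrib]
    refine Finset.sum_congr rfl fun p hp => ?_
    rw [← add_smul, ← Nat.cast_add, Finset.HasAntidiagonal.mem_antidiagonal.1 hp]

end Factorial

end LieSuperalgebra

/-! ### Exponentials of operators that raise the degree -/

namespace LieSuperalgebra

variable {F L : Type*} [Field F] [AddCommGroup L] [Module F L] [LieSuperalgebra F L]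

/-- Evenness expressed by commutation passes to powers, sums and limits; this is how exponentials
and logarithms are seen to be even. -/
lemma mem_endParity_zero_iff {T : Module.End F L} :
    T ∈ endParity F 0 ↔ ∀ p, Commute (proj F p) T := by
  refine ⟨fun h p => end_ext F fun i x hx => ?_, fun h i x hx => ?_⟩
  · have hT := h i x hx
    rw [zero_add] at hT
    rw [Module.End.mul_apply, Module.End.mul_apply]
    by_cases hip : i = p
    · subst hip
      rw [proj_of_mem F hx, proj_of_mem F hT]
    · rw [proj_of_mem_ne F hip hx, proj_of_mem_ne F hip hT, map_zero]
  · have := LinearMap.congr_fun (h i) x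
    rw [Module.End.mul_apply, Module.End.mul_apply, proj_of_mem F hx] at this
    rw [zero_add, ← this]
    exact proj_mem F i _

variable [TopologicalSpace L]

namespace Filtration

variable {S : Filtration F L}

lemma commute_of_forall_sub_mem_raise {A T : Module.End F L} (hA : A ∈ S.raise 0)
    (U : ℕ → Module.End F L) (hU : ∀ K, Commute A (U K))
    (hT : ∀ K : ℕ, T - U K ∈ S.raise K) : Commute A T := by
  refine eq_of_forall_sub_mem_raise (S := S) fun K => ?_
  have h : A * T - T * A = A * (T - U K) - (T - U K) * A := by
    rw [mul_sub, sub_mul, (hU K).eq]; abel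
  rw [h]
  exact sub_mem (mul_mem_raise hA (hT K) (by simp)) (mul_mem_raise (hT K) hA (by simp))

lemma sum_sub_sum_mem_raise {u : ℕ → Module.End F L} (hu : ∀ k : ℕ, u k ∈ S.raise k) {m n : ℕ}
    (h : m ≤ n) : ∑ k ∈ Finset.range n, u k - ∑ k ∈ Finset.range m, u k ∈ S.raise m := by
  rw [← Finset.sum_Ico_eq_sub _ h]
  exact sum_mem fun k hk => raise_mono (Int.ofNat_le.2 (Finset.mem_Ico.1 hk).1) (hu k)

lemma sum_mem_raise_zero {u : ℕ → Module.End F L} (hu : ∀ k : ℕ, u k ∈ S.raise k) (n : ℕ) :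
    ∑ k ∈ Finset.range n, u k ∈ S.raise 0 :=
  sum_mem fun k _ => raise_mono (Int.natCast_nonneg k) (hu k)

lemma expTerm_mem_raise {D : Module.End F L} (hD : D ∈ S.raise 1) (n : ℕ) :
    expTerm (F := F) D n ∈ S.raise n :=
  Submodule.smul_mem _ _ (pow_mem_raise hD n)

variable (S) in
/-- The exponential series of `D` converges to `g` with respect to the filtration. -/
def HasExp (D g : Module.End F L) : Prop :=
  ∀ K : ℕ, g - ∑ n ∈ Finset.range K, expTerm (F := F) D n ∈ S.raise K

lemma exists_hasExp [IsTopologicalAddGroup L] (hL : IsLinearlyCompact F L) {D : Module.End F L}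
    (hD : D ∈ S.raise 1) : ∃ g, S.HasExp D g :=
  exists_end_of_mem_raise hL _ (expTerm_mem_raise hD)

namespace HasExp

variable {D g : Module.End F L}

lemma mem_raise_zero (h : S.HasExp D g) : g ∈ S.raise 0 := by
  simpa using h 0

lemma sub_one_mem (h : S.HasExp D g) : g - 1 ∈ S.raise 1 := by
  simpa [expTerm] using h 1

lemma unique (h : S.HasExp D g) {g' : Module.End F L} (h' : S.HasExp D g') : g = g' :=
  eq_of_forall_sub_mem_raise (S := S) fun K => by
    simpa using sub_mem (h K) (h' K)

lemma zero : S.HasExp 0 1 := fun K => by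
  rcases K with - | K
  · simpa using one_mem_raise
  · rw [Finset.sum_range_succ']
    simp [expTerm]

lemma sum_mem_raise (hD : D ∈ S.raise 1) (K : ℕ) :
    ∑ n ∈ Finset.range K, expTerm (F := F) D n ∈ S.raise 0 :=
  sum_mem_raise_zero (expTerm_mem_raise hD) K

lemma add [CharZero F] {D' g' : Module.End F L} (h : S.HasExp D g) (h' : S.HasExp D' g')
    (hD : D ∈ S.raise 1) (hD' : D' ∈ S.raise 1) (hc : Commute D D') :
    S.HasExp (D + D') (g * g') := fun K => by
  have h1 := sum_antidiagonal_sub_mem (S.raise K) K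
    (fun i j => expTerm (F := F) D i * expTerm (F := F) D' j) fun i j hij =>
      mul_mem_raise (expTerm_mem_raise hD i) (expTerm_mem_raise hD' j) (by lia)
  simp_rw [expTerm_add hc]
  rw [← Finset.sum_mul_sum] at h1
  -- With partial sums `P`, `P'`, the error splits as `g (g' - P') + (g - P) P'` plus the part of `P
  -- P'` outside the triangle. The estimates `map_bracket`, `mul_eq`, `leibniz` and `isExp_conjDer`
  -- below use the same splitting.
  have h2 := mul_mem_raise (h K) (sum_mem_raise hD' K) (add_zero _).ge
  have h3 := mul_mem_raise h.mem_raise_zero (h' K) (zero_add _).ge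
  convert add_mem (add_mem h3 h2) h1 using 1
  rw [mul_sub, sub_mul]
  abel

lemma mul_neg [CharZero F] {g' : Module.End F L} (h : S.HasExp D g) (h' : S.HasExp (-D) g')
    (hD : D ∈ S.raise 1) : g * g' = 1 := by
  have := h.add h' hD (neg_mem hD) (Commute.refl D).neg_right
  rw [add_neg_cancel] at this
  exact this.unique zero

lemma isExp [IsTopologicalAddGroup L] [IsLinearTopology F L] (hL : IsLinearlyCompact F L)
    (h : S.HasExp D g) : IsExp F D g := fun x => by
  obtain ⟨d, hd⟩ := S.exists_depth
  rw [← tendsto_sub_nhds_zero_iff]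
  refine (atTop_basis.tendsto_iff (S.hasBasis_nhds_zero hL)).2 fun j _ =>
    ⟨(j + d).toNat, trivial, fun K hK => ?_⟩
  have := neg_mem (h K (-d) x (hd ▸ trivial))
  rw [LinearMap.sub_apply, neg_sub, LinearMap.sum_apply] at this
  have hK' : (j + d).toNat ≤ K := hK
  exact S.antitone (by lia) this

/-- The exponential of an even derivation respects the bracket. -/
lemma map_bracket [CharZero F] (h : S.HasExp D g) (hD : D ∈ S.raise 1)
    (hder : ∀ x y, D (br F x y) = br F (D x) y + br F x (D y)) (x y : L) :
    g (br F x y) = br F (g x) (g y) := by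
  obtain ⟨d, hd⟩ := S.exists_depth
  have htop : ∀ x, x ∈ S (-d) := fun x => hd ▸ trivial
  -- Both arguments of the bracket are only known to lie in `S (-d)`, whence the loss of `d + d`.
  refine sub_eq_zero.1 (S.eq_zero_of_forall_mem (d + d) fun K => ?_)
  have h1 := sum_antidiagonal_sub_mem (S (K - (d + d))) K
    (fun i j => br F (expTerm (F := F) D i x) (expTerm (F := F) D j y)) fun i j hij =>
      S.antitone (by lia) (S.bracket_mem (expTerm_mem_raise hD i _ x (htop x))
        (expTerm_mem_raise hD j _ y (htop y)))
  have h2 := S.bracket_mem (h K _ x (htop x)) (sum_mem_raise hD K _ y (htop y))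
  have h3 := S.bracket_mem (h.mem_raise_zero _ x (htop x)) (h K _ y (htop y))
  have h4 := h K _ _ (htop (br F x y))
  rw [LinearMap.sub_apply, LinearMap.sum_apply] at h4
  simp only [br, expTerm_leibniz (bracket (F := F) (L := L)) D D D hder] at h4
  have e : ∑ i ∈ Finset.range K, ∑ j ∈ Finset.range K,
      br F (expTerm (F := F) D i x) (expTerm (F := F) D j y) =
      br F ((∑ n ∈ Finset.range K, expTerm (F := F) D n) x)
        ((∑ n ∈ Finset.range K, expTerm (F := F) D n) y) := by
    simp only [br, LinearMap.sum_apply, map_sum]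
    exact Finset.sum_comm
  rw [e] at h1
  convert sub_mem (sub_mem (S.antitone (show (K : ℤ) - (d + d) ≤ _ by lia) h4)
    (add_mem (S.antitone (show (K : ℤ) - (d + d) ≤ _ by lia) h2)
      (S.antitone (show (K : ℤ) - (d + d) ≤ _ by lia) h3))) h1 using 1
  simp only [br, LinearMap.sub_apply, map_sub]
  abel

end HasExp

end Filtration

end LieSuperalgebra

/-! ### Logarithms of unipotent operators -/

namespace LieSuperalgebra

section Choose

variable (F : Type*) [Field F]

/-- The polynomial `T (T - 1) ⋯ (T - k + 1) / k!`. -/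
def choosePoly (k : ℕ) : Polynomial F :=
  Polynomial.C ((k.factorial : F)⁻¹) * descPochhammer F k

variable {F}

lemma choosePoly_eval [CharZero F] (n k : ℕ) : (choosePoly F k).eval (n : F) = n.choose k := by
  have hk : (k.factorial : F) ≠ 0 := Nat.cast_ne_zero.2 (Nat.factorial_ne_zero _)
  rw [choosePoly, Polynomial.eval_mul, Polynomial.eval_C, descPochhammer_eval_eq_descFactorial,
    Nat.descFactorial_eq_factorial_mul_choose, Nat.cast_mul, inv_mul_cancel_left₀ hk]

lemma choosePoly_natDegree_le (k : ℕ) : (choosePoly F k).natDegree ≤ k :=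
  (Polynomial.natDegree_C_mul_le _ _).trans (descPochhammer_natDegree F k).le

lemma choose_eq_sum [CharZero F] (n : ℕ) {k J : ℕ} (h : k < J) :
    (n.choose k : F) = ∑ j ∈ Finset.range J, (choosePoly F k).coeff j * (n : F) ^ j := by
  rw [← choosePoly_eval,
    Polynomial.eval_eq_sum_range' ((choosePoly_natDegree_le k).trans_lt h)]

end Choose

variable {F L : Type*} [Field F] [AddCommGroup L] [Module F L] [LieSuperalgebra F L]
  [TopologicalSpace L]

namespace Filtration

variable {S : Filtration F L}

variable (S) in
/-- The powers of the operator `σ` are given by the series `σ ^ n = ∑ n ^ j • E j`. -/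
structure IsPowerExpansion (σ : Module.End F L) (E : ℕ → Module.End F L) : Prop where
  mem_raise : ∀ j : ℕ, E j ∈ S.raise j
  pow_sub_mem : ∀ n J : ℕ, σ ^ n - ∑ j ∈ Finset.range J, (n : F) ^ j • E j ∈ S.raise J
  commute : ∀ A ∈ S.raise 0, Commute A σ → ∀ j, Commute A (E j)

/-- `E j` is the sum over `k` of the coefficient of `T ^ j` in `T choose k` times `(σ - 1) ^ k`.
That polynomial has degree at most `k`, so only `k ≥ j` contribute and `E j` raises the degree by
`j`. For `j = 1` this is the usual logarithm of `σ`. -/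
lemma exists_isPowerExpansion [CharZero F] [IsTopologicalAddGroup L] (hL : IsLinearlyCompact F L)
    {σ : Module.End F L} (hσ : σ - 1 ∈ S.raise 1) : ∃ E, S.IsPowerExpansion σ E := by
  have hu : ∀ j k : ℕ, (choosePoly F k).coeff j • (σ - 1) ^ k ∈ S.raise k :=
    fun j k => Submodule.smul_mem _ _ (pow_mem_raise hσ k)
  choose E hE using fun j => exists_end_of_mem_raise hL _ (hu j)
  refine ⟨E, fun j => ?_, fun n J => ?_, fun A hA hc j => ?_⟩
  · have := hE j j
    rwa [Finset.sum_eq_zero fun k hk => ?_, sub_zero] at this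
    rw [Polynomial.coeff_eq_zero_of_natDegree_lt
      ((choosePoly_natDegree_le k).trans_lt (Finset.mem_range.1 hk)), zero_smul]
  · have h1 : σ ^ n = ∑ k ∈ Finset.range (n + 1 + J), (n.choose k : F) • (σ - 1) ^ k := by
      have := (Commute.one_right (σ - 1)).add_pow n
      rw [sub_add_cancel] at this
      rw [this]
      refine Finset.sum_subset_zero_on_sdiff (Finset.range_mono (by lia)) (fun k hk => ?_)
        fun k _ => ?_
      · simp only [Finset.mem_sdiff, Finset.mem_range] at hk
        rw [Nat.choose_eq_zero_of_lt (by lia), Nat.cast_zero, zero_smul]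
      · rw [one_pow, mul_one, ← Nat.cast_comm, ← nsmul_eq_mul, Nat.cast_smul_eq_nsmul]
    have h2 := sum_sub_sum_mem_raise (S := S) (u := fun k => (n.choose k : F) • (σ - 1) ^ k)
      (fun k => Submodule.smul_mem _ _ (pow_mem_raise hσ k)) (show J ≤ n + 1 + J by lia)
    have h3 : ∑ k ∈ Finset.range J, (n.choose k : F) • (σ - 1) ^ k =
        ∑ j ∈ Finset.range J, (n : F) ^ j •
          ∑ k ∈ Finset.range J, (choosePoly F k).coeff j • (σ - 1) ^ k := by
      simp only [Finset.smul_sum]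
      rw [Finset.sum_comm]
      refine Finset.sum_congr rfl fun k hk => ?_
      rw [choose_eq_sum n (Finset.mem_range.1 hk), Finset.sum_smul]
      exact Finset.sum_congr rfl fun j _ => by rw [smul_smul, mul_comm]
    have h4 : ∑ j ∈ Finset.range J, (n : F) ^ j •
        (E j - ∑ k ∈ Finset.range J, (choosePoly F k).coeff j • (σ - 1) ^ k) ∈ S.raise J :=
      sum_mem fun j _ => Submodule.smul_mem _ _ (hE j J)
    simp only [smul_sub, Finset.sum_sub_distrib] at h4
    rw [← h3] at h4
    rw [← h1] at h2
    convert sub_mem h2 h4 using 1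
    abel
  · exact commute_of_forall_sub_mem_raise hA _ (fun K => Commute.sum_right _ _ _ fun k _ =>
      ((hc.sub_right (Commute.one_right A)).pow_right k).smul_right _) (hE j)

namespace IsPowerExpansion

variable [CharZero F] {σ : Module.End F L} {E : ℕ → Module.End F L}

/-- At `n = 0` only `j = 0` survives, since `0 ^ 0 = 1`. -/
lemma zero_eq_one (h : S.IsPowerExpansion σ E) : E 0 = 1 := by
  refine (eq_of_forall_sub_mem_raise (S := S) fun K => ?_).symm
  have := h.pow_sub_mem 0 (K + 1)
  rw [Finset.sum_range_succ'] at this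
  exact raise_mono (show (K : ℤ) ≤ (K + 1 : ℕ) by lia) (by simpa using this)

/-- Compare the coefficients of `n ^ i m ^ l` in `σ ^ n σ ^ m = σ ^ (n + m)`, the right side being
expanded by the binomial theorem. -/
lemma mul_eq (h : S.IsPowerExpansion σ E) (i l : ℕ) :
    E i * E l = ((i + l).choose i : F) • E (i + l) := by
  refine eq_of_forall_sub_mem_raise (S := S) fun K => ?_
  -- Large enough that both `i` and `l` occur among the coefficients and that an error of order `J`
  -- is an error of order `K`.
  set J := K + i + l + 1
  refine raise_mono (show (K : ℤ) ≤ J by lia) ?_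
  let v : ℕ → ℕ → Module.End F L := fun i l => E i * E l - ((i + l).choose i : F) • E (i + l)
  have key : ∀ n m : ℕ, ∑ i ∈ Finset.range J, (n : F) ^ i • ∑ l ∈ Finset.range J,
      (m : F) ^ l • v i l ∈ S.raise J := fun n m => by
    have hs : ∀ n : ℕ, ∑ j ∈ Finset.range J, (n : F) ^ j • E j ∈ S.raise 0 := fun n =>
      sum_mem_raise_zero (u := fun j => (n : F) ^ j • E j)
        (fun k => Submodule.smul_mem _ _ (h.mem_raise k)) J
    have hσ : σ ^ n ∈ S.raise 0 := by simpa using h.pow_sub_mem n 0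
    have h1 := mul_mem_raise hσ (h.pow_sub_mem m J) (zero_add _).ge
    have h2 := mul_mem_raise (h.pow_sub_mem n J) (hs m) (add_zero _).ge
    have h3 := h.pow_sub_mem (n + m) J
    have h4 := sum_antidiagonal_sub_mem (S.raise J) J
      (fun i l => ((n : F) ^ i * (m : F) ^ l * ((i + l).choose i : F)) • E (i + l))
      fun i l hil => Submodule.smul_mem _ _ (raise_mono (by exact_mod_cast hil) (h.mem_raise _))
    have e4 : ∑ j ∈ Finset.range J, ((n + m : ℕ) : F) ^ j • E j =
        ∑ j ∈ Finset.range J, ∑ p ∈ Finset.HasAntidiagonal.antidiagonal j,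
          ((n : F) ^ p.1 * (m : F) ^ p.2 * ((p.1 + p.2).choose p.1 : F)) • E (p.1 + p.2) := by
      refine Finset.sum_congr rfl fun j _ => ?_
      rw [Nat.cast_add, (Commute.all (n : F) (m : F)).add_pow', Finset.sum_smul]
      refine Finset.sum_congr rfl fun p hp => ?_
      rw [Finset.HasAntidiagonal.mem_antidiagonal.1 hp, nsmul_eq_mul, mul_comm]
    rw [e4, pow_add] at h3
    have e5 : ∑ i ∈ Finset.range J, (n : F) ^ i • ∑ l ∈ Finset.range J, (m : F) ^ l • v i l =
        (∑ j ∈ Finset.range J, (n : F) ^ j • E j) * (∑ j ∈ Finset.range J, (m : F) ^ j • E j) -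
        ∑ i ∈ Finset.range J, ∑ l ∈ Finset.range J,
          ((n : F) ^ i * (m : F) ^ l * ((i + l).choose i : F)) • E (i + l) := by
      rw [Finset.sum_mul_sum]
      simp only [v, smul_sub, Finset.sum_sub_distrib, Finset.smul_sum, smul_mul_smul_comm,
        smul_smul, mul_assoc]
    rw [e5]
    convert sub_mem (sub_mem h3 (add_mem h1 h2)) h4 using 1
    rw [mul_sub, sub_mul]
    abel
  -- Coefficients are extracted one variable at a time: first that of `n ^ i`, for each fixed `m`,
  -- then that of `m ^ l`.
  exact mem_of_forall_sum_pow_smul_mem (S.raise J) J (v i)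
    (fun m => mem_of_forall_sum_pow_smul_mem (S.raise J) J
      (fun i => ∑ l ∈ Finset.range J, (m : F) ^ l • v i l) (fun n => key n m) (by lia)) (by lia)

/-- The case `i = 1` of `mul_eq` reads `E 1 * E j = (j + 1) • E (j + 1)`, the recursion of the
exponential terms. -/
lemma eq_expTerm (h : S.IsPowerExpansion σ E) (j : ℕ) : E j = expTerm (F := F) (E 1) j := by
  induction j with
  | zero => rw [h.zero_eq_one]; simp [expTerm]
  | succ j ih =>
    have hj : ((j + 1 : ℕ) : F) ≠ 0 := Nat.cast_ne_zero.2 j.succ_ne_zero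
    refine smul_right_injective _ hj ?_
    dsimp only
    have := h.mul_eq 1 j
    rw [Nat.choose_one_right, add_comm 1 j] at this
    rw [succ_smul_expTerm, ← ih, ← this]

lemma hasExp (h : S.IsPowerExpansion σ E) : S.HasExp (E 1) σ := fun K => by
  have := h.pow_sub_mem 1 K
  simp only [Nat.cast_one, one_pow, pow_one, one_smul] at this
  simpa only [← h.eq_expTerm] using this

/-- The logarithm of an automorphism is a derivation. -/
lemma leibniz (h : S.IsPowerExpansion σ E) (hσ : ∀ x y, σ (br F x y) = br F (σ x) (σ y))
    (x y : L) : E 1 (br F x y) = br F (E 1 x) y + br F x (E 1 y) := by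
  obtain ⟨d, hd⟩ := S.exists_depth
  have htop : ∀ x, x ∈ S (-d) := fun x => hd ▸ trivial
  refine sub_eq_zero.1 (S.eq_zero_of_forall_mem (d + d) fun K => ?_)
  set J := K + 2
  set W := S (J - (d + d))
  have hle : ∀ {i : ℤ}, J - (d + d) ≤ i → ∀ {z}, z ∈ S i → z ∈ W := fun hi _ hz =>
    S.antitone hi hz
  -- `v j` is the coefficient of `n ^ j` in the formal difference between `σ ^ n [x, y]` and `[σ ^ n
  -- x, σ ^ n y]`. The coefficient at `j = 1` is the Leibniz defect of `E 1`, because `E 0 = 1`.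
  let v : ℕ → L := fun j => E j (br F x y) -
    ∑ p ∈ Finset.HasAntidiagonal.antidiagonal j, br F (E p.1 x) (E p.2 y)
  have hpow : ∀ n : ℕ, (σ ^ n) (br F x y) = br F ((σ ^ n) x) ((σ ^ n) y) := fun n => by
    induction n with
    | zero => rfl
    | succ n ih => simp only [pow_succ', Module.End.mul_apply, ih, hσ]
  have key : ∀ n : ℕ, ∑ j ∈ Finset.range J, (n : F) ^ j • v j ∈ W := fun n => by
    set T := ∑ j ∈ Finset.range J, (n : F) ^ j • E j with hT
    have hs : T ∈ S.raise 0 := sum_mem_raise_zero (u := fun j => (n : F) ^ j • E j)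
        (fun k => Submodule.smul_mem _ _ (h.mem_raise k)) J
    have hσ : σ ^ n ∈ S.raise 0 := by simpa using h.pow_sub_mem n 0
    have h1 := hle (by lia) (S.bracket_mem (hσ _ x (htop x)) (h.pow_sub_mem n J _ y (htop y)))
    have h2 := hle (by lia) (S.bracket_mem (h.pow_sub_mem n J _ x (htop x)) (hs _ y (htop y)))
    have h3 := hle (by lia) (h.pow_sub_mem n J _ _ (htop (br F x y)))
    have h4 := sum_antidiagonal_sub_mem W J
      (fun i l => ((n : F) ^ (i + l)) • br F (E i x) (E l y))
      fun i l hil => Submodule.smul_mem _ _ (hle (by lia)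
        (S.bracket_mem (h.mem_raise i _ x (htop x)) (h.mem_raise l _ y (htop y))))
    have e4 : ∑ i ∈ Finset.range J, ∑ l ∈ Finset.range J,
        ((n : F) ^ (i + l)) • br F (E i x) (E l y) = br F (T x) (T y) := by
      simp only [hT, br, LinearMap.sum_apply, map_sum, LinearMap.smul_apply, map_smul,
        pow_add]
      rw [Finset.sum_comm]
      simp only [mul_comm, Finset.smul_sum, smul_smul]
    have e5 : ∑ j ∈ Finset.range J, (n : F) ^ j • v j = T (br F x y) -
        ∑ j ∈ Finset.range J, ∑ p ∈ Finset.HasAntidiagonal.antidiagonal j,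
          ((n : F) ^ (p.1 + p.2)) • br F (E p.1 x) (E p.2 y) := by
      simp only [v, hT, smul_sub, Finset.sum_sub_distrib, LinearMap.sum_apply,
        LinearMap.smul_apply, Finset.smul_sum]
      congr 1
      refine Finset.sum_congr rfl fun j _ => Finset.sum_congr rfl fun p hp => ?_
      rw [Finset.HasAntidiagonal.mem_antidiagonal.1 hp]
    rw [e4] at h4
    rw [e5]
    convert add_mem (sub_mem (add_mem h1 h2) h3) h4 using 1
    simp only [LinearMap.sub_apply, br, map_sub] at hpow ⊢
    rw [hpow]
    abel
  have := mem_of_forall_sum_pow_smul_mem W J v key (show 1 < J by lia)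
  refine S.antitone (show (K : ℤ) - (d + d) ≤ J - (d + d) by lia) ?_
  have e : v 1 = E 1 (br F x y) - (br F (E 1 x) y + br F x (E 1 y)) := by
    simp [v, Finset.Nat.antidiagonal_succ, h.zero_eq_one, add_comm]
  rwa [← e]

end IsPowerExpansion

end Filtration

end LieSuperalgebra

/-! ### The action on `Der L`, and `Autf L` as a set of exponentials -/

namespace LieSuperalgebra

variable {F L : Type*} [Field F] [AddCommGroup L] [Module F L] [LieSuperalgebra F L]
  [TopologicalSpace L]

section Der

variable [IsTopologicalAddGroup L] [IsLinearTopology F L]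

lemma continuous_der (D : Der F L) : Continuous D.1 := by
  obtain ⟨D, hD⟩ := D
  obtain ⟨a, ha, b, hb, rfl⟩ := Submodule.mem_sup.1 hD
  exact ha.1.add hb.1

/-- Needed for uniqueness of the sum of an exponential series on `Der L`. -/
lemma t2Space_der [T2Space L] : T2Space (Der F L) := by
  let _ : UniformSpace L := IsTopologicalAddGroup.rightUniformSpace L
  refine T2Space.of_injective_continuous (f := fun D : Der F L => (D.1 : L → L))
    (fun D D' h => Subtype.ext (DFunLike.coe_injective h)) ?_
  exact UniformFun.uniformContinuous_toFun.continuous.comp continuous_induced_dom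

lemma tendsto_der {ι : Type*} {l : Filter ι} {u : ι → Der F L} {D : Der F L}
    (h : ∀ U ∈ 𝓝 (0 : L), ∀ᶠ i in l, ∀ x, (u i).1 x - D.1 x ∈ U) : Tendsto u l (𝓝 D) := by
  let _ : UniformSpace L := IsTopologicalAddGroup.rightUniformSpace L
  rw [nhds_induced, tendsto_comap_iff, UniformFun.tendsto_iff_tendstoUniformly]
  rintro V ⟨U, hU, hUV⟩
  filter_upwards [h U hU] with i hi x
  refine hUV ?_
  have := hi x
  rw [sub_eq_add_neg] at this
  exact this

/-- Left and right multiplication commute, so writing `ad D` as their sum lets its exponential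
factor as a Cauchy product. -/
lemma bracket_der_of_even {D : Der F L} (hD : D ∈ parity (F := F) 0) (D' : Der F L) :
    (bracket (F := F) D D').1 =
      (LinearMap.mulLeft F D.1 + LinearMap.mulRight F (-D.1)) D'.1 := by
  change scomm F D.1 D'.1 = _
  have h : D.1 ∈ derParity F L 0 := hD
  rw [scomm, oddPart_of_even F h.2.1]
  simp [sub_eq_add_neg]

lemma sum_bracket_der_of_even {D : Der F L} (hD : D ∈ parity (F := F) 0) (D' : Der F L) (K : ℕ) :
    (∑ n ∈ Finset.range K, ((n.factorial : F)⁻¹) • (bracket (F := F) D ^ n) D').1 =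
      ∑ n ∈ Finset.range K,
        expTerm (F := F) (LinearMap.mulLeft F D.1 + LinearMap.mulRight F (-D.1)) n D'.1 := by
  have h : ∀ n : ℕ, ((bracket (F := F) D ^ n) D').1 =
      ((LinearMap.mulLeft F D.1 + LinearMap.mulRight F (-D.1)) ^ n) D'.1 := fun n => by
    induction n with
    | zero => rfl
    | succ n ih => rw [pow_succ', pow_succ', Module.End.mul_apply, bracket_der_of_even hD, ih]; rfl
  rw [AddSubmonoidClass.coe_finsetSum]
  exact Finset.sum_congr rfl fun n _ => by rw [Submodule.coe_smul, h]; rfl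

end Der

namespace Filtration

variable {S : Filtration F L}

lemma symb_eq_symb_iff {j : ℤ} {x y : S j} : S.symb j x = S.symb j y ↔ x.1 - y.1 ∈ S (j + 1) := by
  rw [← sub_eq_zero, ← map_sub]
  change DirectSum.lof F ℤ S.GrComp j (S.grMk j (x - y)) = 0 ↔ _
  rw [DirectSum.lof_eq_of, (DirectSum.of_injective j).eq_iff' (map_zero _), grMk_eq_zero_iff]
  rfl

/-- Turns triviality on `Gr L` into the unipotence condition under which exponentials and logarithms
are available. -/
lemma mem_autf_iff {hS : S.IsInvariant} {σ : ContAut F L} :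
    σ ∈ S.Autf hS ↔ ((σ : L ≃ₗ[F] L) : Module.End F L) - 1 ∈ S.raise 1 := by
  have h : ∀ j (x : S j), (S.toAutGr hS σ).1 (S.symb j x) = S.symb j x ↔
      σ.1 x.1 - x.1 ∈ S (j + 1) := fun j x => by
    rw [toAutGr_symb, symb_eq_symb_iff]
  refine ⟨fun hσ j x hx => (h j ⟨x, hx⟩).1 ?_, fun hσ => Subtype.ext (LinearEquiv.ext fun z => ?_)⟩
  · rw [MonoidHom.mem_ker.1 hσ]; rfl
  · change (S.toAutGr hS σ).1 z = z
    induction z using S.gr_induction with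
    | h0 => rw [map_zero]
    | hadd a b ha hb => rw [map_add, ha, hb]
    | hsymb j x => exact (h j x).2 (hσ j x.1 x.2)

variable [CharZero F] [IsTopologicalAddGroup L] [IsLinearTopology F L]

/-- The `n`-th term of the series is the sum of `D ^ i / i! * D' * (-D) ^ l / l!` over `i + l = n`,
and `exp (-D) = σ⁻¹`. Only continuity of `D'` enters, not a bound on its degree, so the estimates
are made for one neighbourhood `S j` at a time. -/
lemma HasExp.isExp_conjDer (hL : IsLinearlyCompact F L) {D : Der F L}
    (hD : D ∈ S.derFiltration 1 ⊓ parity 0) {σ : ContAut F L}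
    (h : S.HasExp D.1 ((σ : L ≃ₗ[F] L) : Module.End F L)) :
    IsExp F (bracket (F := F) D) (conjDer σ).1 := fun D' => by
  obtain ⟨d, hd⟩ := S.exists_depth
  have htop : ∀ x, x ∈ S (-d) := fun x => hd ▸ trivial
  have hD1 : D.1 ∈ S.raise 1 := hD.1
  have hD2 : -D.1 ∈ S.raise 1 := neg_mem hD1
  obtain ⟨τ, hτ⟩ := exists_hasExp hL hD2
  have hτσ : ∀ x, σ.1.symm x = τ x := fun x => σ.1.injective (by
    rw [LinearEquiv.apply_symm_apply]
    exact (LinearMap.congr_fun (h.mul_neg hτ hD1) x).symm)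
  refine tendsto_der fun U hU => ?_
  obtain ⟨j, -, hj⟩ := (S.hasBasis_nhds_zero hL).mem_iff.1 hU
  obtain ⟨m, -, hm⟩ := ((S.hasBasis_nhds_zero hL).tendsto_iff (S.hasBasis_nhds_zero hL)).1
    (map_zero D'.1 ▸ (continuous_der D').tendsto 0) j trivial
  have hm' : ∀ x ∈ S m, D'.1 x ∈ S j := hm
  let W : Submodule F (Module.End F L) := Submodule.compatibleMaps ⊤ (S j)
  -- Here `D'` maps `S m` into `S j`. If `i + l ≥ K`, then either `i ≥ j + d`, and `D ^ i` carries
  -- all of `L` into `S j`, or `l ≥ m + d`, and `(-D) ^ l` carries `L` into `S m`, hence `D' (-D) ^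
  -- l` into `S j`. The bounds do not depend on `x`, as uniform convergence requires.
  filter_upwards [eventually_ge_atTop ((j + d).toNat + (m + d).toNat)] with K hK x
  refine hj ?_
  have hleft : ∀ (A B : Module.End F L) (a : ℤ), A ∈ S.raise a → j + d ≤ a → A * (D'.1 * B) ∈ W :=
    fun A B a hA ha x _ => S.antitone (show j ≤ -d + a by lia) (hA _ _ (htop _))
  have hright : ∀ (A B : Module.End F L) (b : ℤ), A ∈ S.raise 0 → B ∈ S.raise b → m + d ≤ b →
      A * (D'.1 * B) ∈ W := fun A B b hA hB hb x _ => by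
    have := hA _ _ (hm' _ (S.antitone (show m ≤ -d + b by lia) (hB _ x (htop x))))
    rwa [add_zero] at this
  have h1 := sum_antidiagonal_sub_mem W K (fun i l =>
    expTerm (F := F) D.1 i * (D'.1 * expTerm (F := F) (-D.1) l)) fun i l hil => by
      rcases le_total (j + d) i with hi | hi
      · exact hleft _ _ _ (expTerm_mem_raise hD1 i) hi
      · exact hright _ _ _ (raise_mono (Int.natCast_nonneg i) (expTerm_mem_raise hD1 i))
          (expTerm_mem_raise hD2 l) (by lia)
  have h2 := hleft _ (∑ n ∈ Finset.range K, expTerm (F := F) (-D.1) n) _ (h K) (by lia)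
  have h3 := hright _ _ _ h.mem_raise_zero (hτ K) (by lia)
  have e1 : (∑ n ∈ Finset.range K, ((n.factorial : F)⁻¹) • (bracket (F := F) D ^ n) D').1 =
      ∑ n ∈ Finset.range K, ∑ p ∈ Finset.HasAntidiagonal.antidiagonal n,
        expTerm (F := F) D.1 p.1 * (D'.1 * expTerm (F := F) (-D.1) p.2) := by
    rw [sum_bracket_der_of_even hD.2]
    refine Finset.sum_congr rfl fun n _ => ?_
    rw [expTerm_add (LinearMap.commute_mulLeft_right D.1 (-D.1)), LinearMap.sum_apply]
    refine Finset.sum_congr rfl fun p _ => ?_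
    simp only [expTerm, LinearMap.pow_mulLeft, LinearMap.pow_mulRight]
    simp
  have e2 : ((conjDer σ).1 D').1 = (σ.1 : Module.End F L) * (D'.1 * τ) :=
    LinearMap.ext fun x => by
      change σ.1 (D'.1 (σ.1.symm x)) = _
      rw [hτσ]; rfl
  rw [e1, e2, ← LinearMap.sub_apply]
  refine (?_ : _ ∈ W) trivial
  have e3 : ∑ i ∈ Finset.range K, ∑ l ∈ Finset.range K,
      expTerm (F := F) D.1 i * (D'.1 * expTerm (F := F) (-D.1) l) =
      (∑ n ∈ Finset.range K, expTerm (F := F) D.1 n) *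
        (D'.1 * ∑ n ∈ Finset.range K, expTerm (F := F) (-D.1) n) := by
    rw [Finset.mul_sum, Finset.sum_mul_sum]
  rw [e3] at h1
  convert neg_mem (add_mem (add_mem h1 h2) h3) using 1
  rw [mul_sub, mul_sub, sub_mul]
  abel

/-- The exponential of an even element of `(Der L)_1`. -/
lemma exists_mem_autf (hL : IsLinearlyCompact F L) (hS : S.IsInvariant) {D : Der F L}
    (hD : D ∈ S.derFiltration 1 ⊓ parity 0) :
    ∃ σ ∈ S.Autf hS, S.HasExp D.1 ((σ : L ≃ₗ[F] L) : Module.End F L) := by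
  have hD1 : D.1 ∈ S.raise 1 := hD.1
  have hD2 : -D.1 ∈ S.raise 1 := neg_mem hD1
  have heven : ∀ p, Commute (proj F p) D.1 := mem_endParity_zero_iff.1 hD.2.2.1
  obtain ⟨g, hg⟩ := exists_hasExp hL hD1
  obtain ⟨g', hg'⟩ := exists_hasExp hL hD2
  have h1 : g * g' = 1 := hg.mul_neg hg' hD1
  have h2 : g' * g = 1 := hg'.mul_neg ((neg_neg D.1).symm ▸ hg) hD2
  -- The Leibniz rule is given for a homogeneous first argument only; for even `D` it has no signs
  -- and extends by additivity.
  have hder : ∀ x y, D.1 (br F x y) = br F (D.1 x) y + br F x (D.1 y) := fun x y => by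
    have h := (show D.1 ∈ derParity F L 0 from hD.2).2.2
    simp only [ZMod.val_zero, zero_mul, pow_zero, one_smul] at h
    obtain ⟨a, ha, b, hb, rfl⟩ := exists_parity_add F x
    simp only [br, map_add, LinearMap.add_apply] at h ⊢
    rw [h 0 a ha, h 1 b hb]
    abel
  have hpar : ∀ {D g : Module.End F L}, D ∈ S.raise 1 → (∀ p, Commute (proj F p) D) →
      S.HasExp D g → ∀ i x, x ∈ parity (F := F) (L := L) i → g x ∈ parity (F := F) i :=
    fun hD hc hg i x hx => by
      have : _ ∈ endParity F 0 := mem_endParity_zero_iff.2 fun p =>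
        commute_of_forall_sub_mem_raise (S := S) (proj_mem_raise p) _
          (fun K => Commute.sum_right _ _ _ fun n _ => ((hc p).pow_right n).smul_right _) hg
      simpa using this i x hx
  let σ : L ≃ₗ[F] L := LinearEquiv.ofLinearMap g g' h1 h2
  have hσ : σ ∈ ContAut F L := by
    refine ⟨⟨fun i x => ⟨fun hx => ?_, hpar hD1 heven hg i x⟩, hg.map_bracket hD1 hder⟩,
      continuous_of_mem_raise hL hg.mem_raise_zero, continuous_of_mem_raise hL hg'.mem_raise_zero⟩
    have := hpar hD2 (fun p => (heven p).neg_right) hg' i _ hx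
    rwa [show g' (σ x) = x from LinearMap.congr_fun h2 x] at this
  exact ⟨⟨σ, hσ⟩, mem_autf_iff.2 hg.sub_one_mem, hg⟩

/-- The logarithm of an element of `Autf L`. -/
lemma exists_hasExp_of_mem_autf (hL : IsLinearlyCompact F L) {hS : S.IsInvariant}
    {σ : ContAut F L} (hσ : σ ∈ S.Autf hS) : ∃ D ∈ S.derFiltration 1 ⊓ parity 0,
      S.HasExp D.1 ((σ : L ≃ₗ[F] L) : Module.End F L) := by
  obtain ⟨E, hE⟩ := exists_isPowerExpansion hL (mem_autf_iff.1 hσ)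
  have h1 : E 1 ∈ S.raise 1 := hE.mem_raise 1
  have hpar : E 1 ∈ endParity F 0 := mem_endParity_zero_iff.2 fun p =>
    hE.commute _ (proj_mem_raise p) (mem_endParity_zero_iff.1 (fun i x hx => by
      rw [zero_add]; exact (σ.2.1.1 i x).2 hx) p) 1
  have hder : E 1 ∈ derParity F L 0 := ⟨continuous_of_mem_raise hL h1, hpar, fun i x _ y => by
    simpa using hE.leibniz σ.2.1.2 x y⟩
  exact ⟨⟨E 1, derParity_le_der 0 hder⟩, ⟨h1, hder⟩, hE.hasExp⟩

end Filtration

end LieSuperalgebra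

/-! ### Transitivity and restriction to `𝔤_{-1}` -/

namespace LieSuperalgebra

variable {F L : Type*} [Field F] [AddCommGroup L] [Module F L] [LieSuperalgebra F L]
  [TopologicalSpace L]

namespace Filtration

variable {S : Filtration F L}

lemma symb_mem_grPiece {j : ℤ} (x : S j) : S.symb j x ∈ S.grPiece j := ⟨_, rfl⟩

lemma exists_symb_eq {j : ℤ} {z : S.Gr} (hz : z ∈ S.grPiece j) : ∃ x : S j, S.symb j x = z := by
  obtain ⟨a, rfl⟩ := hz
  obtain ⟨x, rfl⟩ := S.grMk_surjective j a
  exact ⟨x, rfl⟩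

lemma br_mem_grPiece {i j : ℤ} {z w : S.Gr} (hz : z ∈ S.grPiece i) (hw : w ∈ S.grPiece j) :
    br F z w ∈ S.grPiece (i + j) := by
  obtain ⟨x, rfl⟩ := exists_symb_eq hz
  obtain ⟨y, rfl⟩ := exists_symb_eq hw
  change S.grBracket _ _ ∈ _
  rw [S.grBracket_symb]
  exact symb_mem_grPiece _

/-- An automorphism of a transitive graded Lie superalgebra is determined by its restriction to
`𝔤_{-1}`. -/
lemma IsTransitive.eq_one (h : S.IsTransitive) {φ : S.AutGr}
    (hφ : ∀ z ∈ S.grPiece (-1), φ.1 z = z) : φ = 1 := by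
  have hbr : ∀ z w, φ.1 (br F z w) = br F (φ.1 z) (φ.1 w) := φ.2.1.2
  have hneg : ∀ n : ℕ, ∀ z ∈ S.grPiece (-((n : ℤ) + 1)), φ.1 z = z := fun n => by
    induction n with
    | zero => simpa using hφ
    | succ n ih =>
      intro z hz
      rw [h.generated (n + 1) (by lia)] at hz
      induction hz using Submodule.span_induction with
      | mem z hz =>
        obtain ⟨u, hu, w, hw, rfl⟩ := hz
        rw [hbr, hφ u hu, ih w (by exact_mod_cast hw)]
      | zero => rw [map_zero]
      | add a b _ _ ha hb => rw [map_add, ha, hb]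
      | smul c a _ ha => rw [map_smul, ha]
  -- The shift by one makes the hypothesis on `𝔤_{-1}` the base case. In the inductive step `[z, w]`
  -- with `w ∈ 𝔤_{-1}` has degree one less and is already fixed, so `[φ z - z, w] = 0`.
  have hpos : ∀ n : ℕ, ∀ z ∈ S.grPiece ((n : ℤ) - 1), φ.1 z = z := fun n => by
    induction n with
    | zero => simpa using hφ
    | succ n ih =>
      intro z hz
      refine sub_eq_zero.1 (h.eq_zero ((n + 1 : ℕ) - 1) (by lia) _
        (sub_mem ((φ.2.2 _ z).2 hz) hz) fun w hw => ?_)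
      have h1 := hbr z w
      rw [hφ w hw, ih _ (by have := br_mem_grPiece hz hw; convert this using 2; push_cast; ring)] at h1
      simp only [br, map_sub, LinearMap.sub_apply] at h1 ⊢
      rw [← h1, sub_self]
  refine Subtype.ext (LinearEquiv.ext fun z => ?_)
  change φ.1 z = z
  induction z using S.gr_induction with
  | h0 => rw [map_zero]
  | hadd a b ha hb => rw [map_add, ha, hb]
  | hsymb j x =>
    have hx := symb_mem_grPiece x
    rcases lt_or_ge j 0 with hj | hj
    · exact hneg (-j - 1).toNat _ (by convert hx using 2; lia)
    · exact hpos (j + 1).toNat _ (by convert hx using 2; lia)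

lemma IsTransitive.restrictPiece_injective (h : S.IsTransitive) :
    Function.Injective (S.restrictPiece (-1)) := by
  refine (injective_iff_map_eq_one _).2 fun φ hφ => h.eq_one fun z hz => ?_
  exact congrArg Subtype.val (LinearEquiv.congr_fun hφ ⟨z, hz⟩)

/-! ### Lifting graded automorphisms of `Gr L` to `L` -/

namespace IsGradedBy

variable {𝔤 : ℤ → Submodule F L} (h : S.IsGradedBy 𝔤)
include h

lemma disjoint (j : ℤ) : Disjoint (𝔤 j) (S (j + 1)) := disjoint_iff.2 (h.inf_eq j)

lemma eq_bot {j : ℤ} (hj : S (j + 1) = ⊤) : 𝔤 j = ⊥ := by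
  simpa [hj] using h.inf_eq j

/-- Induction on `j` from `-d`, where the filtration is all of `L` and the lower pieces vanish; each
step moves one summand `𝔤 j` from `S j` to the other side. -/
lemma isCompl_iSup (j : ℤ) : IsCompl (⨆ i < j, 𝔤 i) (S j) := by
  obtain ⟨d, hd⟩ := S.exists_depth
  have htop : ∀ j : ℤ, j ≤ -d → S j = ⊤ := fun j hj => top_le_iff.1 (hd ▸ S.antitone hj)
  have hbase : ∀ j : ℤ, j ≤ -d → IsCompl (⨆ i < j, 𝔤 i) (S j) := fun j hj => by
    rw [htop j hj, show ⨆ i < j, 𝔤 i = ⊥ from ?_]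
    · exact isCompl_bot_top
    · simp only [iSup_eq_bot]
      exact fun i hi => h.eq_bot (htop _ (by lia))
  rcases le_total j (-d) with hj | hj
  · exact hbase j hj
  induction j, hj using Int.leInduction with
  | base => exact hbase _ le_rfl
  | succ j hj ih =>
    have e : ⨆ i < j + 1, 𝔤 i = (⨆ i < j, 𝔤 i) ⊔ 𝔤 j := by
      refine le_antisymm (iSup₂_le fun i hi => ?_) (sup_le (iSup₂_le fun i hi => ?_) ?_)
      · rcases (Int.lt_add_one_iff.1 hi).lt_or_eq with hi | rfl
        · exact (le_iSup₂ (f := fun i (_ : i < j) => 𝔤 i) i hi).trans le_sup_left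
        · exact le_sup_right
      · exact le_iSup₂ (f := fun i (_ : i < j + 1) => 𝔤 i) i (by lia)
      · exact le_iSup₂ (f := fun i (_ : i < j + 1) => 𝔤 i) j (by lia)
    rw [← h.sup_eq j] at ih
    rw [e]
    exact ⟨(h.disjoint j).disjoint_sup_left_of_disjoint_sup_right ih.disjoint,
      codisjoint_iff.2 (by rw [sup_assoc, ih.sup_eq_top])⟩

/-- This complement is chosen so that the projection onto `𝔤 j` kills all other pieces and all
deeper members of the filtration. -/
lemma isCompl (j : ℤ) : IsCompl (𝔤 j) ((⨆ i < j, 𝔤 i) ⊔ S (j + 1)) := by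
  have hc := h.isCompl_iSup j
  rw [← h.sup_eq j] at hc
  refine ⟨?_, codisjoint_iff.2 (by rw [sup_left_comm, hc.sup_eq_top])⟩
  rw [sup_comm]
  exact (h.disjoint j).disjoint_sup_right_of_disjoint_sup_left hc.disjoint.symm

/-- The projection of `L` onto `𝔤_j`. -/
def pieceProj (j : ℤ) : Module.End F L := Submodule.projection _ _ (h.isCompl j)

lemma pieceProj_mem (j : ℤ) (x : L) : h.pieceProj j x ∈ 𝔤 j := by
  rw [pieceProj, Submodule.projection_apply]
  exact Subtype.property _

lemma pieceProj_of_mem {j : ℤ} {x : L} (hx : x ∈ 𝔤 j) : h.pieceProj j x = x := by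
  rw [pieceProj, Submodule.projection_apply, Submodule.projectionOnto_apply_of_mem_left _ hx]

lemma pieceProj_of_mem_right {j : ℤ} {x : L} (hx : x ∈ (⨆ i < j, 𝔤 i) ⊔ S (j + 1)) :
    h.pieceProj j x = 0 := by
  rw [pieceProj, Submodule.projection_apply, Submodule.projectionOnto_apply_of_mem_right _ hx,
    Submodule.coe_zero]

lemma pieceProj_of_mem_filtration {j k : ℤ} (hjk : j < k) {x : L} (hx : x ∈ S k) :
    h.pieceProj j x = 0 :=
  h.pieceProj_of_mem_right (Submodule.mem_sup_right (S.antitone (by lia) hx))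

lemma pieceProj_of_mem_ne {i j : ℤ} (hij : i ≠ j) {x : L} (hx : x ∈ 𝔤 i) :
    h.pieceProj j x = 0 := by
  rcases hij.lt_or_gt with hlt | hlt
  · exact h.pieceProj_of_mem_right (Submodule.mem_sup_left
      (le_iSup₂ (f := fun i (_ : i < j) => 𝔤 i) i hlt hx))
  · exact h.pieceProj_of_mem_filtration hlt (h.le i hx)

lemma sub_pieceProj_mem {j : ℤ} {x : L} (hx : x ∈ S j) : x - h.pieceProj j x ∈ S (j + 1) := by
  rw [← h.sup_eq j] at hx
  obtain ⟨a, ha, b, hb, rfl⟩ := Submodule.mem_sup.1 hx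
  rwa [map_add, h.pieceProj_of_mem ha, h.pieceProj_of_mem_filtration (lt_add_one j) hb, add_zero,
    add_sub_cancel_left]

/-- Every element is the sum of its convergent series of homogeneous components. The remainder after
`K` terms has the same component in degree `K - d` as `x`, and removing it goes one step deeper. -/
lemma sub_sum_pieceProj_mem {d : ℤ} (hd : S (-d) = ⊤) (K : ℕ) (x : L) :
    x - ∑ k ∈ Finset.range K, h.pieceProj (k - d) x ∈ S (K - d) := by
  induction K with
  | zero => simp [hd]
  | succ K ih =>
    have := h.sub_pieceProj_mem ih
    have e : ∑ k ∈ Finset.range K, h.pieceProj (K - d) (h.pieceProj (k - d) x) = 0 :=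
      Finset.sum_eq_zero fun k hk => h.pieceProj_of_mem_ne (i := k - d)
        (by have := Finset.mem_range.1 hk; lia) (h.pieceProj_mem _ _)
    rw [map_sub, map_sum, e, sub_zero, sub_sub, ← Finset.sum_range_succ] at this
    exact S.antitone (by lia) this

/-- Operators of bounded degree that agree on all `𝔤_j` are equal. -/
lemma end_ext {A B : Module.End F L} {k : ℤ} (hA : A ∈ S.raise k) (hB : B ∈ S.raise k)
    (hAB : ∀ j, ∀ x ∈ 𝔤 j, A x = B x) : A = B := by
  obtain ⟨d, hd⟩ := S.exists_depth
  refine LinearMap.ext fun x => sub_eq_zero.1 (S.eq_zero_of_forall_mem (d - k) fun K => ?_)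
  have := sub_mem hA hB _ _ (h.sub_sum_pieceProj_mem hd K x)
  rw [map_sub, map_sum, Finset.sum_eq_zero fun k _ => by
    rw [LinearMap.sub_apply, hAB _ _ (h.pieceProj_mem _ x), sub_self], sub_zero] at this
  exact S.antitone (by lia) this

/-- The linear map `Gr L → L` that maps each `S_j / S_{j+1}` onto `𝔤_j`. -/
def ofGr : S.Gr →ₗ[F] L :=
  DirectSum.toModule F ℤ L fun j => S.grLift j (h.pieceProj j ∘ₗ (S j).subtype)
    fun _ hx => h.pieceProj_of_mem_filtration (lt_add_one j) hx

lemma ofGr_symb {j : ℤ} (x : S j) : h.ofGr (S.symb j x) = h.pieceProj j x := by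
  rw [ofGr, symb, LinearMap.comp_apply, DirectSum.toModule_lof]
  rfl

lemma ofGr_mem {j : ℤ} {z : S.Gr} (hz : z ∈ S.grPiece j) : h.ofGr z ∈ 𝔤 j := by
  obtain ⟨x, rfl⟩ := exists_symb_eq hz
  rw [ofGr_symb]
  exact h.pieceProj_mem _ _

lemma symb_ofGr {j : ℤ} {z : S.Gr} (hz : z ∈ S.grPiece j) :
    S.symb j ⟨h.ofGr z, h.le j (h.ofGr_mem hz)⟩ = z := by
  obtain ⟨x, rfl⟩ := exists_symb_eq hz
  rw [symb_eq_symb_iff, ← neg_sub]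
  simp only [ofGr_symb]
  exact neg_mem (h.sub_pieceProj_mem x.2)

lemma ofGr_symb_of_mem {j : ℤ} {x : L} (hx : x ∈ 𝔤 j) (hx' : x ∈ S j) :
    h.ofGr (S.symb j ⟨x, hx'⟩) = x := by
  rw [ofGr_symb, h.pieceProj_of_mem hx]

/-- The part of `x` of the opposite parity lies in `𝔤 j`, which is graded, and in `S (j + 1)`, since
`x` agrees modulo `S (j + 1)` with an element of parity `p`. -/
lemma mem_parity_of_symb_mem {j : ℤ} {x : L} (hx : x ∈ 𝔤 j) {p : ZMod 2}
    (hp : S.symb j ⟨x, h.le j hx⟩ ∈ S.grParity p) : x ∈ parity (F := F) p := by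
  obtain ⟨w, hw, hwx⟩ := hp j
  have hwx' : S.symb j w = S.symb j ⟨x, h.le j hx⟩ := by
    have e : S.symb j ⟨x, h.le j hx⟩ j = S.grMk j ⟨x, h.le j hx⟩ := DirectSum.of_eq_same _ _
    rw [e] at hwx
    rw [symb, LinearMap.comp_apply, LinearMap.comp_apply, hwx]
  have h1 := symb_eq_symb_iff.1 hwx'
  have hw' : proj F p w.1 = w.1 := proj_of_mem F hw
  -- Applying `proj p - 1` to `w - x` kills `w` and leaves `x - proj p x`.
  have h2 := sub_mem (proj_mem_raise (S := S) p _ _ h1) ((add_zero (j + 1)).symm ▸ h1)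
  rw [map_sub, hw', add_zero] at h2
  have h3 : x - proj F p x ∈ 𝔤 j := by
    obtain ⟨u, ⟨hu, hu0⟩, v, ⟨hv, hv1⟩, rfl⟩ := Submodule.mem_sup.1 (h.isSuperSubspace _ hx)
    rw [map_add]
    obtain rfl | rfl := zmod_two p
    · rwa [proj_of_mem F hu0, proj_of_mem_ne F one_ne_zero hv1, add_zero, add_sub_cancel_left]
    · rwa [proj_of_mem F hv1, proj_of_mem_ne F zero_ne_one hu0, zero_add, add_sub_cancel_right]
  have h4 : x - proj F p x = 0 := Submodule.disjoint_def.1 (h.disjoint j) _ h3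
    (by convert h2 using 1; simp)
  rw [sub_eq_zero.1 h4]
  exact proj_mem F p x

variable [IsTopologicalAddGroup L]

/-- Graded linear maps of `Gr L` extend to `L`. -/
lemma exists_extension (hL : IsLinearlyCompact F L) (φ : S.AutGr) :
    ∃ T ∈ S.raise 0, ∀ (j : ℤ) (x : L) (hx : x ∈ 𝔤 j),
      T x = h.ofGr (φ.1 (S.symb j ⟨x, h.le j hx⟩)) := by
  obtain ⟨d, hd⟩ := S.exists_depth
  -- `v j` projects to `𝔤 j`, passes to `Gr L`, applies `φ` and comes back. The extension is the sum
  -- of the `v j` over `j ≥ -d`.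
  let v : ℤ → Module.End F L := fun j => h.ofGr ∘ₗ (φ.1 : S.Gr →ₗ[F] S.Gr) ∘ₗ S.symb j ∘ₗ
    (h.pieceProj j).codRestrict (S j) fun x => h.le j (h.pieceProj_mem j x)
  have hv : ∀ j x, v j x ∈ S j := fun j x =>
    h.le j (h.ofGr_mem ((φ.2.2 j _).2 (symb_mem_grPiece _)))
  have hv0 : ∀ j x, h.pieceProj j x = 0 → v j x = 0 := fun j x hx => by
    have : (h.pieceProj j).codRestrict (S j) (fun x => h.le j (h.pieceProj_mem j x)) x = 0 :=
      Subtype.ext hx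
    simp only [v, LinearMap.comp_apply, this, map_zero]
  obtain ⟨T, hT⟩ := exists_end_of_tails hL (S := S) d (fun k => v (k - d)) fun k x => hv _ x
  refine ⟨T, fun j x hx => ?_, fun j x hx => ?_⟩
  · have h1 := hT (j + d).toNat x
    rw [Finset.sum_eq_zero fun k hk => hv0 _ _ (h.pieceProj_of_mem_filtration
      (by have := Finset.mem_range.1 hk; lia) hx), sub_zero] at h1
    exact S.antitone (by lia) h1
  -- The series starts at degree `-d`; in lower degrees `𝔤 j` is zero.
  · rcases lt_or_ge j (-d) with hj | hj
    · have : x = 0 := by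
        rwa [h.eq_bot (top_le_iff.1 (hd ▸ S.antitone (show j + 1 ≤ -d by lia))),
          Submodule.mem_bot] at hx
      subst this
      have e : S.symb j ⟨0, h.le j hx⟩ = 0 := map_zero (S.symb j)
      rw [e]
      simp only [map_zero]
    · refine sub_eq_zero.1 (S.eq_zero_of_forall_mem d fun K => ?_)
      have h1 := hT (K + (j + d).toNat + 1) x
      rw [Finset.sum_eq_single (j + d).toNat] at h1
      · have e : v (((j + d).toNat : ℤ) - d) x = h.ofGr (φ.1 (S.symb j ⟨x, h.le j hx⟩)) := by
          rw [show ((j + d).toNat : ℤ) - d = j by lia]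
          have : (h.pieceProj j).codRestrict (S j) (fun x => h.le j (h.pieceProj_mem j x)) x =
              ⟨x, h.le j hx⟩ := Subtype.ext (h.pieceProj_of_mem hx)
          simp only [v, LinearMap.comp_apply, this]
          rfl
        rw [e] at h1
        exact S.antitone (by push_cast; lia) h1
      · exact fun k _ hk => hv0 _ _ (h.pieceProj_of_mem_ne (by lia) hx)
      · exact fun hk => absurd (Finset.mem_range.2 (by lia)) hk

/-- The operator on `L` that acts on all `𝔤_j` as `φ`. -/
def extend (hL : IsLinearlyCompact F L) (φ : S.AutGr) : Module.End F L :=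
  (h.exists_extension hL φ).choose

variable (hL : IsLinearlyCompact F L)
include hL

lemma extend_mem_raise (φ : S.AutGr) : h.extend hL φ ∈ S.raise 0 :=
  (h.exists_extension hL φ).choose_spec.1

lemma extend_apply (φ : S.AutGr) {j : ℤ} {x : L} (hx : x ∈ 𝔤 j) :
    h.extend hL φ x = h.ofGr (φ.1 (S.symb j ⟨x, h.le j hx⟩)) :=
  (h.exists_extension hL φ).choose_spec.2 j x hx

lemma extend_mem (φ : S.AutGr) {j : ℤ} {x : L} (hx : x ∈ 𝔤 j) : h.extend hL φ x ∈ 𝔤 j := by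
  rw [h.extend_apply hL φ hx]
  exact h.ofGr_mem ((φ.2.2 j _).2 (symb_mem_grPiece _))

lemma symb_extend_of_mem (φ : S.AutGr) {j : ℤ} {x : L} (hx : x ∈ 𝔤 j)
    (hx' : h.extend hL φ x ∈ S j) :
    S.symb j ⟨h.extend hL φ x, hx'⟩ = φ.1 (S.symb j ⟨x, h.le j hx⟩) := by
  simp only [h.extend_apply hL φ hx]
  exact h.symb_ofGr ((φ.2.2 j _).2 (symb_mem_grPiece _))

/-- A representative may be replaced by its component in `𝔤 j`, because the extension preserves `S
(j + 1)`. This makes the extension a lift of `φ` on all of `Gr L`. -/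
lemma symb_extend (φ : S.AutGr) {j : ℤ} (x : S j) (hx' : h.extend hL φ x ∈ S j) :
    S.symb j ⟨h.extend hL φ x, hx'⟩ = φ.1 (S.symb j x) := by
  have h1 := h.sub_pieceProj_mem x.2
  have hp := h.pieceProj_mem j x
  have e : S.symb j x = S.symb j ⟨h.pieceProj j x, h.le j hp⟩ := symb_eq_symb_iff.2 h1
  rw [e, ← h.symb_extend_of_mem hL φ hp (h.le j (h.extend_mem hL φ hp)), symb_eq_symb_iff,
    ← map_sub]
  exact S.antitone (add_zero _).ge (h.extend_mem_raise hL φ _ _ h1)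

lemma extend_mul (φ ψ : S.AutGr) : h.extend hL (φ * ψ) = h.extend hL φ * h.extend hL ψ := by
  refine h.end_ext (k := 0) (h.extend_mem_raise hL _)
    (mul_mem_raise (h.extend_mem_raise hL _) (h.extend_mem_raise hL _) (by simp)) fun j x hx => ?_
  have hψ := h.extend_mem hL ψ hx
  rw [Module.End.mul_apply, h.extend_apply hL φ hψ, h.extend_apply hL (φ * ψ) hx,
    h.symb_extend_of_mem hL ψ hx]
  rfl

lemma extend_one : h.extend hL 1 = 1 :=
  h.end_ext (k := 0) (h.extend_mem_raise hL _) one_mem_raise fun j x hx => by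
    rw [h.extend_apply hL 1 hx]
    exact h.ofGr_symb_of_mem hx _

lemma extend_mem_parity (φ : S.AutGr) {p : ZMod 2} {x : L} (hx : x ∈ parity (F := F) p) :
    h.extend hL φ x ∈ parity (F := F) p := by
  have hT := h.extend_mem_raise hL φ
  have key : h.extend hL φ ∈ endParity F 0 := mem_endParity_zero_iff.2 fun q => by
    refine h.end_ext (mul_mem_raise (proj_mem_raise q) hT (zero_add _).ge)
      (mul_mem_raise hT (proj_mem_raise q) (zero_add _).ge) fun j x hx => ?_
    have hom : ∀ (i : ZMod 2), ∀ x ∈ 𝔤 j, x ∈ parity (F := F) i →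
        proj F q (h.extend hL φ x) = h.extend hL φ (proj F q x) := fun i x hx hi => by
      have hTx : h.extend hL φ x ∈ parity (F := F) i :=
        h.mem_parity_of_symb_mem (h.extend_mem hL φ hx) (by
          rw [h.symb_extend_of_mem hL φ hx]
          exact (φ.2.1.1 i _).2 (S.symb_mem_grParity hi))
      by_cases hiq : i = q
      · subst hiq
        rw [proj_of_mem F hi, proj_of_mem F hTx]
      · rw [proj_of_mem_ne F hiq hi, proj_of_mem_ne F hiq hTx, map_zero]
    obtain ⟨u, ⟨hu, hu0⟩, v, ⟨hv, hv1⟩, rfl⟩ := Submodule.mem_sup.1 (h.isSuperSubspace _ hx)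
    simp only [Module.End.mul_apply, map_add, hom 0 u hu hu0, hom 1 v hv hv1]
  simpa using key p x hx

lemma extend_br (φ : S.AutGr) (x y : L) :
    h.extend hL φ (br F x y) = br F (h.extend hL φ x) (h.extend hL φ y) := by
  obtain ⟨d, hd⟩ := S.exists_depth
  have htop : ∀ x, x ∈ S (-d) := fun x => hd ▸ trivial
  set T := h.extend hL φ
  have hT : T ∈ S.raise 0 := h.extend_mem_raise hL φ
  have homog : ∀ i j, ∀ x ∈ 𝔤 i, ∀ y ∈ 𝔤 j, T (br F x y) = br F (T x) (T y) :=
    fun i j x hx y hy => by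
      have hTx := h.extend_mem hL φ hx
      have hTy := h.extend_mem hL φ hy
      rw [h.extend_apply hL φ (h.bracket_mem hx hy),
        ← h.ofGr_symb_of_mem (h.bracket_mem hTx hTy) (S.bracket_mem (h.le i hTx) (h.le j hTy))]
      congr 1
      rw [← S.grBracket_symb ⟨x, h.le i hx⟩ ⟨y, h.le j hy⟩,
        ← S.grBracket_symb ⟨T x, h.le i hTx⟩ ⟨T y, h.le j hTy⟩,
        h.symb_extend_of_mem hL φ hx, h.symb_extend_of_mem hL φ hy]
      exact φ.2.1.2 _ _
  -- Bracketing with a fixed element has bounded degree on either side, so density of the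
  -- homogeneous elements applies first in `y`, for homogeneous `x`, and then in `x`, for arbitrary
  -- `y`.
  have hbr : ∀ {k : ℤ} {x : L}, x ∈ S k → bracket (F := F) x ∈ S.raise k := fun hx j y hy =>
    S.antitone (add_comm _ _).le (S.bracket_mem hx hy)
  have hbr' : ∀ y : L, (bracket (F := F)).flip y ∈ S.raise (-d) := fun y j x hx =>
    S.bracket_mem hx (htop y)
  have left : ∀ i, ∀ x ∈ 𝔤 i, ∀ y, T (br F x y) = br F (T x) (T y) := fun i x hx =>
    LinearMap.congr_fun (h.end_ext (A := T * bracket x) (B := bracket (T x) * T) (k := i)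
      (mul_mem_raise hT (hbr (h.le i hx)) (zero_add _).ge)
      (mul_mem_raise (hbr (h.le i (h.extend_mem hL φ hx))) hT (add_zero _).ge)
      fun j y hy => homog i j x hx y hy)
  exact LinearMap.congr_fun (h.end_ext (A := T * (bracket (F := F)).flip y)
    (B := (bracket (F := F)).flip (T y) * T) (k := -d)
    (mul_mem_raise hT (hbr' y) (zero_add _).ge) (mul_mem_raise (hbr' (T y)) hT (add_zero _).ge)
    fun i x hx => left i x hx y) x

/-- The embedding of `Aut (Gr L)` into the group of continuous automorphisms of `L`. -/
def extendHom [IsLinearTopology F L] : S.AutGr →* ContAut F L :=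
  have inv_left : ∀ φ : S.AutGr, h.extend hL φ⁻¹ * h.extend hL φ = 1 := fun φ => by
    rw [← extend_mul, inv_mul_cancel, extend_one]
  have inv_right : ∀ φ : S.AutGr, h.extend hL φ * h.extend hL φ⁻¹ = 1 := fun φ => by
    rw [← extend_mul, mul_inv_cancel, extend_one]
  MonoidHom.mk' (fun φ => ⟨LinearEquiv.ofLinearMap (h.extend hL φ) (h.extend hL φ⁻¹)
      (inv_right φ) (inv_left φ),
    ⟨fun p x => ⟨fun hx => by
        have e : h.extend hL φ⁻¹ (h.extend hL φ x) = x := LinearMap.congr_fun (inv_left φ) x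
        exact e ▸ h.extend_mem_parity hL φ⁻¹ hx,
      h.extend_mem_parity hL φ⟩, h.extend_br hL φ⟩,
    continuous_of_mem_raise hL (h.extend_mem_raise hL φ),
    continuous_of_mem_raise hL (h.extend_mem_raise hL φ⁻¹)⟩)
    fun φ ψ => Subtype.ext (LinearEquiv.ext (LinearMap.congr_fun (h.extend_mul hL φ ψ)))

lemma toAutGr_extendHom [IsLinearTopology F L] (hS : S.IsInvariant) (φ : S.AutGr) :
    S.toAutGr hS (h.extendHom hL φ) = φ := by
  refine Subtype.ext (LinearEquiv.ext fun z => ?_)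
  induction z using S.gr_induction with
  | h0 => simp only [map_zero]
  | hadd a b ha hb => rw [map_add, ha, hb, map_add]
  | hsymb j x =>
    rw [toAutGr_symb]
    exact h.symb_extend hL φ x _

end IsGradedBy

end Filtration

end LieSuperalgebra

/-- A group homomorphism with a section identifies the group with the semidirect product of the
kernel and the quotient. -/
lemma exists_mulEquiv_semidirectProduct {G H : Type*} [Group G] [Group H] (π : G →* H) (s : H →* G)
    (hs : ∀ x, π (s x) = x) : ∃ e : π.ker ⋊[MulAut.conjNormal.comp s] H ≃* G,
      ∀ a, e a = (a.left : G) * s a.right := by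
  let f : π.ker ⋊[MulAut.conjNormal.comp s] H →* G :=
    SemidirectProduct.lift π.ker.subtype s fun x => MonoidHom.ext fun y => by simp
  have hf : ∀ a, f a = (a.left : G) * s a.right := fun a => rfl
  refine ⟨MulEquiv.ofBijective f ⟨(injective_iff_map_eq_one f).2 fun a ha => ?_, fun g => ?_⟩, hf⟩
  · rw [hf] at ha
    have h1 : a.right = 1 := by
      have := congrArg π ha
      rwa [map_mul, hs, map_one, MonoidHom.mem_ker.1 a.left.2, one_mul] at this
    rw [h1, map_one, mul_one] at ha
    exact SemidirectProduct.ext (Subtype.ext ha) h1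
  · refine ⟨⟨⟨g * (s (π g))⁻¹, ?_⟩, π g⟩, by simp [hf]⟩
    rw [MonoidHom.mem_ker, map_mul, map_inv, hs, mul_inv_cancel]

end

/-! ### Proof of (a), (b) and (c) -/

theorem mainTheorem11 {F : Type*} [Field F] [CharZero F] [IsAlgClosed F]
    {L : Type*} [AddCommGroup L] [Module F L] [LieSuperalgebra F L]
    [TopologicalSpace L] [IsTopologicalAddGroup L] [IsLinearTopology F L]
    (hL : LieSuperalgebra.IsLinearlyCompact F L) (hdim : ¬ FiniteDimensional F L)
    (S : LieSuperalgebra.Filtration F L) (hS : S.IsInvariant) (htr : S.IsTransitive) :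
    -- (a) the restriction map from `Autgr L` to `GL (𝔤_{-1})` is injective
    Function.Injective ((S.restrictPiece (-1)).comp (S.Autgr hS).subtype) ∧
    -- (b) `Autf L` acts on `Der L` by inner automorphisms, and `Autf L = exp ad (Der L)_1`,
    -- both on `Der L` and on `L`
    ((∀ σ ∈ S.Autf hS,
        LieSuperalgebra.conjDer σ ∈ LieSuperalgebra.InnerAut F (LieSuperalgebra.Der F L)) ∧
      LieSuperalgebra.conjDer '' (S.Autf hS : Set (LieSuperalgebra.ContAut F L)) =
        LieSuperalgebra.expAd F (LieSuperalgebra.Der F L) (S.derFiltration 1) ∧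
      (∀ σ : LieSuperalgebra.ContAut F L, σ ∈ S.Autf hS ↔
        ∃ D ∈ S.derFiltration 1 ⊓ LieSuperalgebra.parity 0,
          LieSuperalgebra.IsExp F D.1 σ.1 ∧
          LieSuperalgebra.IsExp F (LieSuperalgebra.bracket D) (LieSuperalgebra.conjDer σ).1) ∧
      (∀ D ∈ S.derFiltration 1 ⊓ LieSuperalgebra.parity 0, ∃ σ ∈ S.Autf hS,
          LieSuperalgebra.IsExp F D.1 σ.1 ∧
          LieSuperalgebra.IsExp F (LieSuperalgebra.bracket D) (LieSuperalgebra.conjDer σ).1)) ∧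
    -- (c) if the filtration comes from a grading `𝔤`, then `Autgr L = Aut (Gr L)`, and `Aut L` is
    -- the semidirect product of `Autf L` and `Aut (Gr L)`, embedded in `Aut L` by `s`
    (∀ (𝔤 : ℤ → Submodule F L) (h𝔤 : S.IsGradedBy 𝔤),
      S.Autgr hS = ⊤ ∧
      ∃ s : S.AutGr →* LieSuperalgebra.ContAut F L,
        (∀ (φ : S.AutGr) (j : ℤ) (x : L) (hx : x ∈ 𝔤 j), ∃ hy : (s φ).1 x ∈ 𝔤 j,
          S.symb j ⟨(s φ).1 x, h𝔤.le j hy⟩ = φ.1 (S.symb j ⟨x, h𝔤.le j hx⟩)) ∧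
        (∀ φ : S.AutGr, S.toAutGr hS (s φ) = φ) ∧
        ∃ e : S.Autf hS ⋊[MulAut.conjNormal.comp s] S.AutGr ≃* LieSuperalgebra.ContAut F L,
          ∀ a, e a = (a.left : LieSuperalgebra.ContAut F L) * s a.right) := by 
  have := hL.t2
  have hT2 := LieSuperalgebra.t2Space_der (F := F) (L := L)
  have hlog : ∀ σ ∈ S.Autf hS, ∃ D ∈ S.derFiltration 1 ⊓ LieSuperalgebra.parity 0,
      LieSuperalgebra.IsExp F D.1 σ.1 ∧
      LieSuperalgebra.IsExp F (LieSuperalgebra.bracket D) (LieSuperalgebra.conjDer σ).1 :=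
    fun σ hσ => by
      obtain ⟨D, hD, h⟩ := LieSuperalgebra.Filtration.exists_hasExp_of_mem_autf hL hσ
      exact ⟨D, hD, h.isExp hL, h.isExp_conjDer hL hD⟩
  have hexp : ∀ D ∈ S.derFiltration 1 ⊓ LieSuperalgebra.parity 0, ∃ σ ∈ S.Autf hS,
      LieSuperalgebra.IsExp F D.1 σ.1 ∧
      LieSuperalgebra.IsExp F (LieSuperalgebra.bracket D) (LieSuperalgebra.conjDer σ).1 :=
    fun D hD => by
      obtain ⟨σ, hσ, h⟩ := LieSuperalgebra.Filtration.exists_mem_autf hL hS hD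
      exact ⟨σ, hσ, h.isExp hL, h.isExp_conjDer hL hD⟩
  refine ⟨?_, ⟨fun σ hσ => ?_, Set.Subset.antisymm ?_ ?_, fun σ => ⟨hlog σ, ?_⟩, hexp⟩,
    fun 𝔤 h𝔤 => ⟨?_, h𝔤.extendHom hL, fun φ j x hx => ?_, h𝔤.toAutGr_extendHom hL hS,
      exists_mulEquiv_semidirectProduct _ _ (h𝔤.toAutGr_extendHom hL hS)⟩⟩
  · exact htr.restrictPiece_injective.comp Subtype.val_injective
  · obtain ⟨D, hD, -, h⟩ := hlog σ hσ
    exact Subgroup.subset_closure ⟨D, hD.2, h⟩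
  · rintro _ ⟨σ, hσ, rfl⟩
    obtain ⟨D, hD, -, h⟩ := hlog σ hσ
    exact ⟨D, hD, h⟩
  · rintro g ⟨D, hD, hg⟩
    obtain ⟨σ, hσ, -, h⟩ := hexp D hD
    -- An automorphism given as a sum of `exp (ad D)` must be conjugation by `exp D`, as limits in
    -- `Der L` are unique.
    exact ⟨σ, hσ, Subtype.ext (LinearEquiv.ext fun D' => tendsto_nhds_unique (h D') (hg D'))⟩
  · rintro ⟨D, hD, h, -⟩
    obtain ⟨σ', hσ', h', -⟩ := hexp D hD
    have e : σ = σ' := Subtype.ext (LinearEquiv.ext fun x => tendsto_nhds_unique (h x) (h' x))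
    exact e ▸ hσ'
  · exact MonoidHom.range_eq_top.2 fun φ => ⟨_, h𝔤.toAutGr_extendHom hL hS φ⟩
  · exact ⟨h𝔤.extend_mem hL φ hx, h𝔤.symb_extend_of_mem hL φ hx _⟩
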